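/- Let $V_1,V_2$ be finite types of first-order and second-order variables. The formulas of (full) S1S are $$\varphi,\psi ::= x<y \mid x\in X \mid \varphi\land\psi \mid \neg\varphi \mid \exists x.\varphi \mid \exists X.\varphi \qquad (x,y\in V_1,\ X\in V_2).$$ An interpretation $I$ consists of functions $V_1\to\mathbb N$ and $V_2\to(\mathbb N\to\{\mathsf{true},\mathsf{false}\})$, and satisfaction $I\models\varphi$ is defined as usual, where first-order variables range over $\mathbb N$ and second-order variables over all boolean sequences (that is, decidable sets of numbers). A Ramseyan factorisation of a sequence $\sigma$ over a finite semigroup $(\Gamma,+)$ is a sequence $\tau_0,\tau_1,\tau_2,\dots$ of nonempty strings over $\Gamma$ such that $\sigma$ agrees with the infinite concatenation $\tau_0\tau_1\tau_2\cdots$ and all strings $\tau_1,\tau_2,\tau_3,\dots$ have the same color, where the color of $a_0\cdots a_n$ is $a_0+\dots+a_n$. Let RF be the proposition that every sequence over a finite semigroup has a Ramseyan factorisation. **Theorem.** Constructively, assuming RF: 1. satisfaction satisfies excluded middle: for every interpretation $I$ and every formula $\varphi$, $I\models\varphi$ or $I\not\models\varphi$; 2. satisfiability is decidable: there is a computable boolean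 function $f$ such that for every formula $\varphi$, $\exists I.\ I\models\varphi$ if and only if $f(\varphi)=\mathsf{true}$. Here formulas are given to $f$ through an injective coding by natural numbers, variables being numbered arbitrarily, and $f$ is one function for all $V_1,V_2$. "Constructively" is made precise as follows. The claims are asserted in the ordinary sense, and also in the interpretation of intuitionistic logic in sheaves over an arbitrary complete Heyting algebra $H$: propositions take truth values in $H$, connectives are the Heyting operations of $H$, quantifiers are suprema and infima in $H$, and a sequence over $A$ is a functional relation $\sigma:\mathbb N\times A\to H$ to the degree $$\mathrm E(\sigma)=\bigwedge_n\Bigl(\bigvee_a\sigma(n,a)\wedge\bigwedge_{a,b}\bigl(\sigma(n,a)\wedge\sigma(n,b)\Rightarrow[a=b]\bigr)\Bigr),$$ where $[p]$ is the top element of $H$ if $p$ holds and the bottom element otherwise. Write $[\![p]\!]_H\in H$ for the truth value of $p$ in this interpretation, and $\mathrm E(I)$ for the infimum of the degrees $\mathrm E(I(X))$, $X\in V_2$. Then for every complete Heyting algebra $H$, all finite $V_1,V_2$ and every formula $\varphi$, 1. $[\![\mathrm{RF}]\!]_H\le \mathrm E(I)\Rightarrow\bigl([\![I\models\varphi]\!]_H\vee\neg[\![I\models\varphi]\!]_H\bigr)$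 for every $H$-valued interpretation $I$; 2. $[\![\mathrm{RF}]\!]_H\le\bigl([\![\exists I.\ I\models\varphi]\!]_H\Leftrightarrow[f(\varphi)=\mathsf{true}]\bigr)$ for a computable function $f$ that depends neither on $H$ nor on $V_1,V_2$. -/

import Mathlib

universe u v w

namespace S1S

/-! ### Formulas of S1S and their semantics over all sequences -/

/-- Formulas of full S1S, with first-order variables from `V₁` and second-order variables
from `V₂`. -/
inductive Form (V₁ : Type v) (V₂ : Type w) : Type (max v w) where
  | lt (x y : V₁) : Form V₁ V₂
  | mem (x : V₁) (X : V₂) : Form V₁ V₂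
  | and (φ ψ : Form V₁ V₂) : Form V₁ V₂
  | neg (φ : Form V₁ V₂) : Form V₁ V₂
  | exFst (x : V₁) (φ : Form V₁ V₂) : Form V₁ V₂
  | exSnd (X : V₂) (φ : Form V₁ V₂) : Form V₁ V₂

/-- An interpretation maps first-order variables to numbers and second-order variables to
boolean sequences. -/
structure Interp (V₁ : Type v) (V₂ : Type w) : Type (max v w) where
  fst : V₁ → ℕ
  snd : V₂ → ℕ → Bool

/-- The satisfaction relation `I ⊨ φ`. -/
def Satisfies {V₁ : Type v} {V₂ : Type w} [DecidableEq V₁] [DecidableEq V₂] :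
    Interp V₁ V₂ → Form V₁ V₂ → Prop
  | I, .lt x y => I.fst x < I.fst y
  | I, .mem x X => I.snd X (I.fst x) = true
  | I, .and φ ψ => Satisfies I φ ∧ Satisfies I ψ
  | I, .neg φ => ¬ Satisfies I φ
  | I, .exFst x φ => ∃ n : ℕ, Satisfies ⟨Function.update I.fst x n, I.snd⟩ φ
  | I, .exSnd X φ => ∃ β : ℕ → Bool, Satisfies ⟨I.fst, Function.update I.snd X β⟩ φ

/-- The code of a formula as a natural number, for given numberings `e₁`, `e₂` of the
variables. -/
def Form.code {V₁ : Type v} {V₂ : Type w} (e₁ : V₁ ↪ ℕ) (e₂ : V₂ ↪ ℕ) : Form V₁ V₂ → ℕ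
  | .lt x y => 6 * Nat.pair (e₁ x) (e₁ y)
  | .mem x X => 6 * Nat.pair (e₁ x) (e₂ X) + 1
  | .and φ ψ => 6 * Nat.pair (φ.code e₁ e₂) (ψ.code e₁ e₂) + 2
  | .neg φ => 6 * φ.code e₁ e₂ + 3
  | .exFst x φ => 6 * Nat.pair (e₁ x) (φ.code e₁ e₂) + 4
  | .exSnd X φ => 6 * Nat.pair (e₂ X) (φ.code e₁ e₂) + 5

/-- Different formulas have different codes. -/
theorem Form.code_injective {V₁ : Type v} {V₂ : Type w} (e₁ : V₁ ↪ ℕ) (e₂ : V₂ ↪ ℕ) :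
    Function.Injective (Form.code e₁ e₂) := by
  intro φ
  induction φ with
  | lt x y =>
    intro ψ h
    cases ψ <;> simp only [Form.code] at h <;> first | omega | skip
    have h2 := Nat.pair_eq_pair.1 (Nat.eq_of_mul_eq_mul_left (by norm_num) h)
    rw [e₁.injective h2.1, e₁.injective h2.2]
  | mem x X =>
    intro ψ h
    cases ψ <;> simp only [Form.code] at h <;> first | omega | skip
    have h2 := Nat.pair_eq_pair.1 (Nat.eq_of_mul_eq_mul_left (by norm_num) (Nat.succ.inj h))
    rw [e₁.injective h2.1, e₂.injective h2.2]
  | and φ ψ ihφ ihψ =>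
    intro χ h
    cases χ <;> simp only [Form.code] at h <;> first | omega | skip
    have h2 := Nat.pair_eq_pair.1
      (Nat.eq_of_mul_eq_mul_left (by norm_num) (Nat.add_right_cancel h))
    rw [ihφ h2.1, ihψ h2.2]
  | neg φ ih =>
    intro χ h
    cases χ <;> simp only [Form.code] at h <;> first | omega | skip
    rw [ih (Nat.eq_of_mul_eq_mul_left (by norm_num) (Nat.add_right_cancel h))]
  | exFst x φ ih =>
    intro χ h
    cases χ <;> simp only [Form.code] at h <;> first | omega | skip
    have h2 := Nat.pair_eq_pair.1
      (Nat.eq_of_mul_eq_mul_left (by norm_num) (Nat.add_right_cancel h))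
    rw [e₁.injective h2.1, ih h2.2]
  | exSnd X φ ih =>
    intro χ h
    cases χ <;> simp only [Form.code] at h <;> first | omega | skip
    have h2 := Nat.pair_eq_pair.1
      (Nat.eq_of_mul_eq_mul_left (by norm_num) (Nat.add_right_cancel h))
    rw [e₂.injective h2.1, ih h2.2]

/-! ### Ramseyan factorisations -/

/-- Nonempty strings over `A`. -/
abbrev Str (A : Type u) : Type u := FreeAddSemigroup A

/-- The concatenation of finitely many strings, as a list of letters. -/
def concat {A : Type u} (ws : List (Str A)) : List A :=
  ws.flatMap fun w => w.head :: w.tail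

/-- The color `a₀ + ⋯ + aₙ` of the string `a₀ ⋯ aₙ`. -/
def color {Γ : Type u} [AddSemigroup Γ] (w : Str Γ) : Γ := FreeAddSemigroup.lift id w

/-- `σ` agrees with the infinite concatenation `(τ 0)(τ 1)(τ 2)⋯`. -/
def IsFactorisation {A : Type u} (σ : ℕ → A) (τ : ℕ → Str A) : Prop :=
  ∀ (k : ℕ) (j : Fin (concat ((List.range k).map τ)).length),
    σ j = (concat ((List.range k).map τ)).get j

/-- A factorisation `τ` of `σ` such that `τ 1, τ 2, τ 3, …` all have the same color. -/
def IsRamseyanFactorisation {Γ : Type u} [AddSemigroup Γ] (σ : ℕ → Γ) (τ : ℕ → Str Γ) : Prop :=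
  IsFactorisation σ τ ∧ ∀ i j : ℕ, color (τ (i + 1)) = color (τ (j + 1))

/-- RF: every sequence over a finite semigroup has a Ramseyan factorisation. -/
def RF : Prop :=
  ∀ (Γ : Type) (_ : AddSemigroup Γ) (_ : Finite Γ) (σ : ℕ → Γ),
    ∃ τ : ℕ → Str Γ, IsRamseyanFactorisation σ τ

/-! ### The constructive reading

Lean's ambient logic is classical, so the constructive content of a claim is expressed by reading
the claim in the sheaf model over an arbitrary complete Heyting algebra (frame) `H`: propositions
take truth values in `H`, connectives and quantifiers are interpreted by the Heyting algebra
operations, suprema and infima, `H`-valued sequences are `H`-valued functional relations, and a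
proposition `p` implies a proposition `q` if `p ≤ q`. For `H = Prop` this is the ordinary
reading. The natural numbers, the strings over a finite type, the finite types and the formulas
are the constant objects of the model, so that quantifiers over them are plain suprema and
infima. -/

/-- The truth value of a decidable proposition about numbers, letters or strings. -/
def truth (H : Type u) [Order.Frame H] (p : Prop) : H := ⨆ _ : p, ⊤

/-- Candidates for `H`-valued sequences over `A`: `σ n a` is the truth value of `σ n = a`. -/
abbrev HSeq (H : Type u) (A : Type v) : Type (max u v) := ℕ → A → H

/-- The truth value of "`σ` is a sequence over `A`", i.e. of "for every `n` there is exactly one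
`a` with `σ n = a`". -/
def HSeq.extent {H : Type u} [Order.Frame H] {A : Type v} (σ : HSeq H A) : H :=
  ⨅ n : ℕ, (⨆ a : A, σ n a) ⊓ ⨅ (a : A) (b : A), (σ n a ⊓ σ n b) ⇨ truth H (a = b)

/-- The truth value of "`σ` agrees with the infinite concatenation `(τ 0)(τ 1)(τ 2)⋯`". -/
def hIsFactorisation {H : Type u} [Order.Frame H] {A : Type v}
    (σ : HSeq H A) (τ : HSeq H (Str A)) : H :=
  ⨅ ws : List (Str A), (⨅ i : Fin ws.length, τ i (ws.get i)) ⇨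
    ⨅ j : Fin (concat ws).length, σ j ((concat ws).get j)

/-- The truth value of "`τ` is a Ramseyan factorisation of `σ`". -/
def hIsRamseyanFactorisation {H : Type u} [Order.Frame H] {Γ : Type v} [AddSemigroup Γ]
    (σ : HSeq H Γ) (τ : HSeq H (Str Γ)) : H :=
  hIsFactorisation σ τ ⊓
    ⨅ (i : ℕ) (j : ℕ) (x : Str Γ) (y : Str Γ),
      (τ (i + 1) x ⊓ τ (j + 1) y) ⇨ truth H (color x = color y)

/-- The truth value of RF. -/
def hRF (H : Type u) [Order.Frame H] : H :=
  ⨅ (Γ : Type) (_ : AddSemigroup Γ) (_ : Finite Γ) (σ : HSeq H Γ),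
    σ.extent ⇨ ⨆ τ : HSeq H (Str Γ), τ.extent ⊓ hIsRamseyanFactorisation σ τ

/-- Candidates for `H`-valued interpretations. -/
structure HInterp (H : Type u) (V₁ : Type v) (V₂ : Type w) : Type (max u v w) where
  fst : V₁ → ℕ
  snd : V₂ → HSeq H Bool

/-- The truth value of "`I` is an interpretation". -/
def HInterp.extent {H : Type u} [Order.Frame H] {V₁ : Type v} {V₂ : Type w}
    (I : HInterp H V₁ V₂) : H :=
  ⨅ X : V₂, (I.snd X).extent

/-- The truth value of `I ⊨ φ`. -/
def hSatisfies {H : Type u} [Order.Frame H] {V₁ : Type v} {V₂ : Type w}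
    [DecidableEq V₁] [DecidableEq V₂] : HInterp H V₁ V₂ → Form V₁ V₂ → H
  | I, .lt x y => truth H (I.fst x < I.fst y)
  | I, .mem x X => I.snd X (I.fst x) true
  | I, .and φ ψ => hSatisfies I φ ⊓ hSatisfies I ψ
  | I, .neg φ => (hSatisfies I φ)ᶜ
  | I, .exFst x φ => ⨆ n : ℕ, hSatisfies ⟨Function.update I.fst x n, I.snd⟩ φ
  | I, .exSnd X φ => ⨆ β : HSeq H Bool,
      β.extent ⊓ hSatisfies ⟨I.fst, Function.update I.snd X β⟩ φ

/-- The truth value of "`φ` is satisfiable", i.e. of `∃ I, I ⊨ φ`. -/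
def hSatisfiable (H : Type u) [Order.Frame H] {V₁ : Type v} {V₂ : Type w}
    [DecidableEq V₁] [DecidableEq V₂] (φ : Form V₁ V₂) : H :=
  ⨆ I : HInterp H V₁ V₂, I.extent ⊓ hSatisfies I φ

end S1S

/-! To every formula belong a finite semigroup, a coloring `h` of letters and a relation `P` such
that, whenever the word of an interpretation is cut into a segment of color `s` and segments of
color `e`, the formula is true if `P s e` and false if not (`Recognises`). Atoms use a small
explicit semigroup, conjunction a product, negation the complement of `P`, and quantification over a
sequence the powerset semigroup (`Recognises.ex`), where refuting a putative witness takes another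
use of RF. First-order variables are treated as singleton sequences.

RF supplies cuts for any interpretation, and `P s e` is decided in the metatheory; this gives
excluded middle (`Recognises.em`). Satisfiability is truth of the existential closure, which can be
evaluated on the all-false word; there the cuts are explicit and only `P (h 0) (h 0)` has to be
known (`Recognises.const`, with `0` the all-false letter). The semigroups are tabulated by numbers
in a primitive recursive way that does not mention `H`.

A frame need not have points, but an `H`-valued sequence at a stage `u` has a set `supp` of ordinary
sequences all of whose prefixes are consistent with it. By bar induction (`le_of_supp`), `u ≤ g`
follows if each of them has a prefix forcing `g`. Hence the combinatorics is done classically, point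
by point, and transfers to `H` as long as everything constructed depends continuously on the point
(`Cont`, `push`). A factorisation provided by RF is paired with the given sequence, so that its
strings become part of the point (`le_of_cuts`). -/

namespace S1S

/-! ### Points of sequences in a frame -/

section Points

variable {H : Type u} [Order.Frame H]

theorem truth_of {p : Prop} (hp : p) : truth H p = ⊤ := by simp [truth, hp]

theorem truth_of_not {p : Prop} (hp : ¬ p) : truth H p = ⊥ := by simp [truth, hp]

theorem of_not_le_bot {u : H} {p : Prop} (hu : ¬ u ≤ ⊥) (h : u ≤ truth H p) : p := by
  by_contra hp
  rw [truth_of_not hp] at h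
  exact hu h

/-- Existential elimination: the stages `u ⊓ p x` cover `u`. -/
theorem le_of_forall_inf_le {ι : Sort v} {u g : H} {p : ι → H} (h : u ≤ ⨆ x, p x)
    (k : ∀ x, u ⊓ p x ≤ g) : u ≤ g := by
  calc u ≤ u ⊓ ⨆ x, p x := le_inf le_rfl h
    _ = ⨆ x, u ⊓ p x := inf_iSup_eq _ _
    _ ≤ g := iSup_le k

section

variable {A : Type v} {B : Type w}

theorem HSeq.le_extent_iff {u : H} {σ : HSeq H A} :
    u ≤ σ.extent ↔ (∀ n, u ≤ ⨆ a, σ n a) ∧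
      ∀ n a b, u ⊓ (σ n a ⊓ σ n b) ≤ truth H (a = b) := by
  simp only [HSeq.extent, le_iInf_iff, le_inf_iff, le_himp_iff]
  exact ⟨fun h => ⟨fun n => (h n).1, fun n => (h n).2⟩, fun h n => ⟨h.1 n, h.2 n⟩⟩

/-- The truth value of "`σ` and `z` agree below `n`". -/
def pre (σ : HSeq H A) (z : ℕ → A) (n : ℕ) : H := ⨅ i : ℕ, ⨅ _ : i < n, σ i (z i)

theorem pre_le {σ : HSeq H A} {z : ℕ → A} {n i : ℕ} (h : i < n) : pre σ z n ≤ σ i (z i) :=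
  iInf₂_le i h

theorem pre_zero (σ : HSeq H A) (z : ℕ → A) : pre σ z 0 = ⊤ := by simp [pre]

theorem pre_anti (σ : HSeq H A) (z : ℕ → A) {m n : ℕ} (h : m ≤ n) : pre σ z n ≤ pre σ z m :=
  le_iInf₂ fun _ hi => pre_le (hi.trans_le h)

theorem pre_congr (σ : HSeq H A) {z z' : ℕ → A} {n : ℕ} (h : ∀ i < n, z i = z' i) :
    pre σ z n = pre σ z' n :=
  iInf_congr fun i => iInf_congr fun hi => by rw [h i hi]

theorem pre_inf_le (σ : HSeq H A) (z : ℕ → A) (n : ℕ) :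
    pre σ z n ⊓ σ n (z n) ≤ pre σ z (n + 1) :=
  le_iInf₂ fun i hi => by
    rcases Nat.lt_succ_iff_lt_or_eq.1 hi with h | rfl
    · exact inf_le_left.trans (pre_le h)
    · exact inf_le_right

/-- If `u` is not below `g`, some sequence of the metatheory has no initial segment on which
`u` is below `g`. -/
theorem exists_point {u g : H} {σ : HSeq H A} (hu : u ≤ σ.extent) (hg : ¬ u ≤ g) :
    ∃ z : ℕ → A, ∀ n, ¬ u ⊓ pre σ z n ≤ g := by
  classical
  have htot := (HSeq.le_extent_iff.1 hu).1
  have hne : Nonempty A := by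
    by_contra hA
    rw [not_nonempty_iff] at hA
    exact hg ((htot 0).trans (by simp))
  -- If every one-letter extension forced `g`, totality of `σ` at `n` would force `g` on the prefix
  -- itself. So a bad prefix has a bad extension, and dependent choice builds `z`.
  have step : ∀ (n : ℕ) (z : ℕ → A), ¬ u ⊓ pre σ z n ≤ g →
      ∃ a, ¬ u ⊓ pre σ (Function.update z n a) (n + 1) ≤ g := by
    intro n z hz
    by_contra! hc
    refine hz (le_of_forall_inf_le (inf_le_left.trans (htot n)) fun a => le_trans ?_ (hc a))
    rw [inf_assoc]
    refine inf_le_inf_left _ (le_trans ?_ (pre_inf_le _ _ _))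
    rw [Function.update_self, pre_congr σ (z := z) (z' := Function.update z n a)]
    exact fun i hi => (Function.update_of_ne hi.ne _ _).symm
  choose a ha using step
  let S : ∀ n : ℕ, {z : ℕ → A // ¬ u ⊓ pre σ z n ≤ g} := fun n =>
    Nat.rec ⟨fun _ => hne.some, by simpa [pre_zero] using hg⟩
      (fun n z => ⟨Function.update z.1 n (a n z.1 z.2), ha n z.1 z.2⟩) n
  have hS : ∀ n, (S (n + 1)).1 = Function.update (S n).1 n (a n (S n).1 (S n).2) :=
    fun n => rfl
  have agree : ∀ n, ∀ i < n, (S (i + 1)).1 i = (S n).1 i := by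
    intro n
    induction n with
    | zero => intro i hi; omega
    | succ n ih =>
      intro i hi
      rcases Nat.lt_succ_iff_lt_or_eq.1 hi with h | rfl
      · rw [ih i h, hS n, Function.update_of_ne h.ne]
      · rfl
  refine ⟨fun i => (S (i + 1)).1 i, fun n => ?_⟩
  rw [pre_congr σ (agree n)]
  exact (S n).2

/-- The sequences of the metatheory whose initial segments are all consistent with `σ` at
stage `u`. -/
def supp (u : H) (σ : HSeq H A) : Set (ℕ → A) := {z | ∀ n, ¬ u ⊓ pre σ z n ≤ ⊥}

theorem supp_mono {u v : H} (h : v ≤ u) (σ : HSeq H A) : supp v σ ⊆ supp u σ :=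
  fun _ hz n hn => hz n ((inf_le_inf_right _ h).trans hn)

/-- Bar induction, as the contrapositive of `exists_point`: a point without a prefix forcing `g` has
in particular no prefix forcing `⊥`, so it lies in the support. -/
theorem le_of_supp {u g : H} {σ : HSeq H A} (hu : u ≤ σ.extent)
    (h : ∀ z ∈ supp u σ, ∃ n, u ⊓ pre σ z n ≤ g) : u ≤ g := by
  by_contra hg
  obtain ⟨z, hz⟩ := exists_point hu hg
  obtain ⟨n, hn⟩ := h z fun n hn => hz n (hn.trans bot_le)
  exact hz n hn

/-- A long enough prefix of `z` is consistent and forces both `σ n = z n` and `σ n = a`; equality in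
`A` is either true or forces `⊥`. -/
theorem supp_eq_of_inf_le {u : H} {σ : HSeq H A} (hu : u ≤ σ.extent) {z : ℕ → A}
    (hz : z ∈ supp u σ) {m n : ℕ} {a : A} (h : u ⊓ pre σ z m ≤ σ n a) : z n = a := by
  refine of_not_le_bot (hz (max m (n + 1))) (le_trans ?_ ((HSeq.le_extent_iff.1 hu).2 n _ _))
  refine le_inf inf_le_left (le_inf ?_ (le_trans ?_ h))
  · exact inf_le_right.trans (pre_le (by omega))
  · exact inf_le_inf_left _ (pre_anti _ _ (le_max_left _ _))

/-- The neighbourhoods of `z` in `supp u σ`. -/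
def nb (u : H) (σ : HSeq H A) (z : ℕ → A) : Filter (ℕ → A) :=
  ⨅ m : ℕ, Filter.principal {z' | z' ∈ supp u σ ∧ ∀ i < m, z' i = z i}

theorem eventually_nb {u : H} {σ : HSeq H A} {z : ℕ → A} {p : (ℕ → A) → Prop} :
    (∀ᶠ z' in nb u σ z, p z') ↔ ∃ m, ∀ z' ∈ supp u σ, (∀ i < m, z' i = z i) → p z' := by
  have hd : Directed (· ≥ ·) fun m : ℕ =>
      Filter.principal {z' | z' ∈ supp u σ ∧ ∀ i < m, z' i = z i} := by
    intro a b
    refine ⟨max a b, ?_, ?_⟩ <;>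
    · simp only [ge_iff_le, Filter.le_principal_iff, Filter.mem_principal]
      exact fun z' hz' => ⟨hz'.1, fun i hi => hz'.2 i (lt_of_lt_of_le hi (by simp))⟩
  rw [Filter.Eventually, nb, Filter.mem_iInf_of_directed hd]
  simp only [Filter.mem_principal, Set.subset_def, Set.mem_ofPred_eq, and_imp]

/-- `F` is continuous on `supp u σ`. -/
def Cont (u : H) (σ : HSeq H A) (F : (ℕ → A) → ℕ → B) : Prop :=
  ∀ z ∈ supp u σ, ∀ n, ∀ᶠ z' in nb u σ z, F z' n = F z n

theorem nb_mono {u v : H} (h : v ≤ u) (σ : HSeq H A) (z : ℕ → A) : nb v σ z ≤ nb u σ z :=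
  iInf_mono fun _ => Filter.principal_mono.2 fun _ hz => ⟨supp_mono h σ hz.1, hz.2⟩

theorem Cont.mono {u v : H} {σ : HSeq H A} {F : (ℕ → A) → ℕ → B} (hF : Cont u σ F)
    (h : v ≤ u) : Cont v σ F :=
  fun z hz n => (hF z (supp_mono h σ hz) n).filter_mono (nb_mono h σ z)

theorem Cont.eventually_lt {u : H} {σ : HSeq H A} {F : (ℕ → A) → ℕ → B} (hF : Cont u σ F)
    {z : ℕ → A} (hz : z ∈ supp u σ) (n : ℕ) :
    ∀ᶠ z' in nb u σ z, ∀ i < n, F z' i = F z i :=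
  (Filter.eventually_all_finite (Set.finite_lt_nat n)).2 fun i _ => hF z hz i

/-- The sequence `β` is `F σ` at stage `u`. -/
def Rep (u : H) (σ : HSeq H A) (F : (ℕ → A) → ℕ → B) (β : HSeq H B) : Prop :=
  ∀ z ∈ supp u σ, ∀ n, ∃ m, u ⊓ pre σ z m ≤ β n (F z n)

theorem Rep.mono {u v : H} {σ : HSeq H A} {F : (ℕ → A) → ℕ → B} {β : HSeq H B}
    (hF : Rep u σ F β) (h : v ≤ u) : Rep v σ F β := fun z hz n => by
  obtain ⟨m, hm⟩ := hF z (supp_mono h σ hz) n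
  exact ⟨m, (inf_le_inf_right _ h).trans hm⟩

theorem Rep.eq_of_inf_le {u : H} {σ : HSeq H A} {F : (ℕ → A) → ℕ → B} {β : HSeq H B}
    (hF : Rep u σ F β) (hβ : u ≤ β.extent) {z : ℕ → A} (hz : z ∈ supp u σ) {m n : ℕ} {b : B}
    (h : u ⊓ pre σ z m ≤ β n b) : F z n = b := by
  obtain ⟨m', hm'⟩ := hF z hz n
  refine of_not_le_bot (hz (max m m')) (le_trans ?_ ((HSeq.le_extent_iff.1 hβ).2 n _ _))
  refine le_inf inf_le_left (le_inf (le_trans ?_ hm') (le_trans ?_ h)) <;>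
  exact inf_le_inf_left _ (pre_anti _ _ (by simp))

/-- The prefix of `z` that forces the value of `β n` is shared by all nearby points, and it forces
the same value there. -/
theorem Rep.cont {u : H} {σ : HSeq H A} {F : (ℕ → A) → ℕ → B} {β : HSeq H B}
    (hF : Rep u σ F β) (hβ : u ≤ β.extent) : Cont u σ F := fun z hz n => by
  obtain ⟨m, hm⟩ := hF z hz n
  refine eventually_nb.2 ⟨m, fun z' hz' h => ?_⟩
  refine hF.eq_of_inf_le hβ hz' (m := m) ?_
  rwa [pre_congr σ h]

/-- The image of `σ` under a map that is continuous on `supp u σ`. -/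
def push (u : H) (σ : HSeq H A) (F : (ℕ → A) → ℕ → B) : HSeq H B := fun n b =>
  ⨆ (z : ℕ → A) (m : ℕ) (_ : ∀ z' ∈ supp u σ, (∀ i < m, z' i = z i) → F z' n = b), pre σ z m

theorem rep_push {u : H} {σ : HSeq H A} {F : (ℕ → A) → ℕ → B} (hF : Cont u σ F) :
    Rep u σ F (push u σ F) := fun z hz n => by
  obtain ⟨m, hm⟩ := eventually_nb.1 (hF z hz n)
  exact ⟨m, inf_le_right.trans (le_iSup_of_le z (le_iSup_of_le m (le_iSup_of_le hm le_rfl)))⟩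

/-- Totality is bar induction with the prefixes given by continuity. For uniqueness, any point of
the stage where two prefixes both hold extends both, so `a` and `b` are both its value at `n`. -/
theorem extent_push {u : H} {σ : HSeq H A} {F : (ℕ → A) → ℕ → B} (hσ : u ≤ σ.extent)
    (hF : Cont u σ F) : u ≤ (push u σ F).extent := by
  refine HSeq.le_extent_iff.2 ⟨fun n => le_of_supp hσ fun z hz => ?_, fun n a b => ?_⟩
  · obtain ⟨m, hm⟩ := rep_push hF z hz n
    exact ⟨m, hm.trans (le_iSup (push u σ F n) _)⟩
  · simp only [push, inf_iSup_eq, iSup_inf_eq, iSup_le_iff]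
    intro z₁ m₁ h₁ z₂ m₂ h₂
    refine le_of_supp (σ := σ) (inf_le_left.trans hσ) fun z hz => ⟨0, ?_⟩
    have hz' := supp_mono inf_le_left σ hz
    have ha := h₁ z hz' fun i hi => supp_eq_of_inf_le (inf_le_left.trans hσ) hz (m := 0)
      (inf_le_left.trans (inf_le_right.trans (inf_le_right.trans (pre_le hi))))
    have hb := h₂ z hz' fun i hi => supp_eq_of_inf_le (inf_le_left.trans hσ) hz (m := 0)
      (inf_le_left.trans (inf_le_right.trans (inf_le_left.trans (pre_le hi))))
    rw [truth_of (hb.symm.trans ha)]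
    exact le_top

/-- The sequence of pairs. -/
def zip (σ : HSeq H A) (τ : HSeq H B) : HSeq H (A × B) := fun n p => σ n p.1 ⊓ τ n p.2

theorem extent_zip {u : H} {σ : HSeq H A} {τ : HSeq H B} (hσ : u ≤ σ.extent)
    (hτ : u ≤ τ.extent) : u ≤ (zip σ τ).extent := by
  rw [HSeq.le_extent_iff] at *
  refine ⟨fun n => ?_, fun n a b => ?_⟩
  · refine le_of_forall_inf_le (hσ.1 n) fun a =>
      le_of_forall_inf_le (inf_le_left.trans (hτ.1 n)) fun b => le_iSup_of_le (a, b) ?_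
    exact inf_le_inf_right _ inf_le_right
  · have h₁ : u ⊓ (zip σ τ n a ⊓ zip σ τ n b) ≤ truth H (a.1 = b.1) :=
      (inf_le_inf_left _ (inf_le_inf inf_le_left inf_le_left)).trans (hσ.2 n _ _)
    have h₂ : u ⊓ (zip σ τ n a ⊓ zip σ τ n b) ≤ truth H (a.2 = b.2) :=
      (inf_le_inf_left _ (inf_le_inf inf_le_right inf_le_right)).trans (hτ.2 n _ _)
    by_cases e : a = b
    · rw [truth_of e]; exact le_top
    · by_cases e₁ : a.1 = b.1
      · rw [truth_of_not fun e₂ => e (Prod.ext e₁ e₂)] at h₂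
        exact h₂.trans bot_le
      · rw [truth_of_not e₁] at h₁
        exact h₁.trans bot_le

theorem pre_zip_le_left (σ : HSeq H A) (τ : HSeq H B) (z : ℕ → A × B) (n : ℕ) :
    pre (zip σ τ) z n ≤ pre σ (fun i => (z i).1) n :=
  le_iInf₂ fun _ hi => (pre_le hi).trans inf_le_left

theorem supp_zip_left {u : H} {σ : HSeq H A} {τ : HSeq H B} {z : ℕ → A × B}
    (hz : z ∈ supp u (zip σ τ)) : (fun i => (z i).1) ∈ supp u σ :=
  fun n hn => hz n ((inf_le_inf_left _ (pre_zip_le_left σ τ z n)).trans hn)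

end

variable {A : Type v} {B : Type w} {C : Type*}

theorem Cont.zip_left {u : H} {σ : HSeq H A} {F : (ℕ → A) → ℕ → C} (hF : Cont u σ F)
    (τ : HSeq H B) : Cont u (zip σ τ) fun z => F fun i => (z i).1 := fun z hz n => by
  obtain ⟨m, hm⟩ := eventually_nb.1 (hF _ (supp_zip_left hz) n)
  exact eventually_nb.2 ⟨m, fun z' hz' h => hm _ (supp_zip_left hz') fun i hi => by rw [h i hi]⟩

theorem Rep.zip_left {u : H} {σ : HSeq H A} {F : (ℕ → A) → ℕ → C} {β : HSeq H C}
    (hF : Rep u σ F β) (τ : HSeq H B) : Rep u (zip σ τ) (fun z => F fun i => (z i).1) β :=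
  fun z hz n => by
    obtain ⟨m, hm⟩ := hF _ (supp_zip_left hz) n
    exact ⟨m, (inf_le_inf_left _ (pre_zip_le_left σ τ z m)).trans hm⟩

theorem rep_zip_right (u : H) (σ : HSeq H A) (τ : HSeq H B) :
    Rep u (zip σ τ) (fun z i => (z i).2) τ :=
  fun _ _ n => ⟨n + 1, inf_le_right.trans ((pre_le n.lt_succ_self).trans inf_le_right)⟩

end Points

/-! ### Colors of segments -/

section Colors

variable {Γ : Type v} [AddSemigroup Γ]

/-- The color of the segment of `c` from position `p` to before position `q`, if `p < q`. -/
def col (c : ℕ → Γ) (p : ℕ) : ℕ → Γ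
  -- Values for `q ≤ p` are junk: a semigroup has no neutral element to color the empty segment.
  | 0 => c p
  | q + 1 => if q ≤ p then c p else col c p q + c q

theorem col_single (c : ℕ → Γ) (p : ℕ) : col c p (p + 1) = c p := by simp [col]

theorem col_succ (c : ℕ → Γ) {p q : ℕ} (h : p < q) : col c p (q + 1) = col c p q + c q := by
  simp [col, h]

theorem col_congr {c d : ℕ → Γ} {p q : ℕ} (hpq : p < q)
    (h : ∀ n, p ≤ n → n < q → c n = d n) : col c p q = col d p q := by
  induction q, hpq using Nat.le_induction with
  | base => rw [col_single, col_single, h p le_rfl (by omega)]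
  | succ q hq ih =>
    rw [col_succ c hq, col_succ d hq, ih fun n h₁ h₂ => h n h₁ (by omega),
      h q (by omega) (by omega)]

theorem col_add (c : ℕ → Γ) {p q r : ℕ} (hpq : p < q) (hqr : q < r) :
    col c p q + col c q r = col c p r := by
  induction r, hqr using Nat.le_induction with
  | base => rw [col_single, col_succ c hpq]
  | succ r hr ih => rw [col_succ c hr, col_succ c (hpq.trans hr), ← add_assoc, ih]

theorem col_map {Δ : Type w} [AddSemigroup Δ] (f : Γ → Δ) (hf : ∀ a b, f (a + b) = f a + f b)
    (c : ℕ → Γ) {p q : ℕ} (hpq : p < q) : col (fun n => f (c n)) p q = f (col c p q) := by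
  induction q, hpq using Nat.le_induction with
  | base => rw [col_single, col_single]
  | succ q hq ih => rw [col_succ _ hq, col_succ _ hq, ih, hf]

/-- Regrouping of a sum. It turns cuts of the sequence of segment colors into coarser cuts of the
word. -/
theorem col_blocks (c : ℕ → Γ) {k : ℕ → ℕ} (hk : StrictMono k) {i j : ℕ} (hij : i < j) :
    col (fun n => col c (k n) (k (n + 1))) i j = col c (k i) (k j) := by
  induction j, hij using Nat.le_induction with
  | base => rw [col_single]
  | succ j hj ih => rw [col_succ _ hj, ih, col_add c (hk hj) (hk j.lt_succ_self)]

/-- `pw e j` is the `(j + 1)`-fold sum of `e`. -/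
def pw (e : Γ) : ℕ → Γ
  | 0 => e
  | j + 1 => pw e j + e

theorem col_const {c : ℕ → Γ} {e : Γ} {i : ℕ} (h : ∀ n, i ≤ n → c n = e) (m : ℕ) :
    col c i (i + m + 1) = pw e m := by
  induction m with
  | zero => rw [add_zero, col_single, h i le_rfl, pw]
  | succ m ih =>
    rw [← add_assoc, col_succ c (by omega : i < i + m + 1), ih, h _ (by omega), pw]

/-- The positions `0 = k 0 < k 1 < ⋯` cut `c` into a segment of color `s` and segments of
color `e`. -/
structure Cuts (k : ℕ → ℕ) (c : ℕ → Γ) (s e : Γ) : Prop where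
  zero : k 0 = 0
  mono : StrictMono k
  head : col c (k 0) (k 1) = s
  tail : ∀ i, col c (k (i + 1)) (k (i + 2)) = e

theorem Cuts.col_tail {k : ℕ → ℕ} {c : ℕ → Γ} {s e : Γ} (h : Cuts k c s e) {i : ℕ}
    (hi : 1 ≤ i) (m : ℕ) : col c (k i) (k (i + m + 1)) = pw e m := by
  rw [← col_blocks c h.mono (by omega : i < i + m + 1)]
  refine col_const (fun n hn => ?_) m
  obtain ⟨n, rfl⟩ := Nat.exists_eq_add_of_le' (hi.trans hn)
  exact h.tail n

/-- Up to `k (j + 2)` there are the head and `j + 1` further segments, and `pw e j` has `j + 1`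
summands. -/
theorem Cuts.col_head {k : ℕ → ℕ} {c : ℕ → Γ} {s e : Γ} (h : Cuts k c s e) (j : ℕ) :
    col c 0 (k (j + 2)) = s + pw e j := by
  have h0 := h.zero
  rw [← h.head, ← h.col_tail le_rfl j, add_comm 1 j, col_add c (h.mono zero_lt_one)
    (h.mono (by omega)), h0]

theorem Cuts.map {Δ : Type w} [AddSemigroup Δ] {f : Γ → Δ}
    (hf : ∀ a b, f (a + b) = f a + f b) {k : ℕ → ℕ} {c : ℕ → Γ} {s e : Γ} (h : Cuts k c s e) :
    Cuts k (fun n => f (c n)) (f s) (f e) where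
  zero := h.zero
  mono := h.mono
  head := by rw [col_map f hf c (h.mono zero_lt_one), h.head]
  tail i := by rw [col_map f hf c (h.mono (Nat.lt_succ_self _)), h.tail]

theorem color_mk (a : Γ) (l : List Γ) : color (⟨a, l⟩ : Str Γ) = l.foldl (· + ·) a := by
  simp [color, FreeAddSemigroup.lift]

theorem col_eq_foldl (c : ℕ → Γ) (p : ℕ) (a : Γ) (l : List Γ)
    (h : ∀ j (hj : j < (a :: l).length), c (p + j) = (a :: l)[j]) :
    col c p (p + (a :: l).length) = l.foldl (· + ·) a := by
  induction l using List.reverseRecOn with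
  | nil => simpa [col_single] using h 0 (by simp)
  | append_singleton l b ih =>
    have e : p + (a :: (l ++ [b])).length = p + (a :: l).length + 1 := by simp; omega
    rw [e, col_succ c (by simp), ih, List.foldl_append]
    · have := h (l.length + 1) (by simp)
      simp only [List.foldl_cons, List.foldl_nil]
      congr 1
      simpa using this
    · intro j hj
      rw [h j (by simp at hj ⊢; omega)]
      simp only [← List.cons_append]
      rw [List.getElem_append_left]

/-- The position where the `i`-th string of a factorisation starts. -/
def start {A : Type v} (τ : ℕ → Str A) (i : ℕ) : ℕ := (concat ((List.range i).map τ)).length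

theorem start_succ {A : Type v} (τ : ℕ → Str A) (i : ℕ) :
    start τ (i + 1) = start τ i + ((τ i).head :: (τ i).tail).length := by
  simp [start, concat, List.range_succ]

/-- Strings are nonempty, so their starting positions increase strictly, and each segment of `σ`
between two of them spells the corresponding string. -/
theorem cuts_of_isRamseyanFactorisation {σ : ℕ → Γ} {τ : ℕ → Str Γ}
    (h : IsRamseyanFactorisation σ τ) :
    Cuts (start τ) σ (color (τ 0)) (color (τ 1)) := by
  have key : ∀ i, col σ (start τ i) (start τ (i + 1)) = color (τ i) := by
    intro i
    rw [start_succ, col_eq_foldl]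
    · rw [← color_mk]
    · intro j hj
      have hl : start τ i + j < (concat ((List.range (i + 1)).map τ)).length := by
        have := start_succ τ i
        rw [start] at this
        omega
      have := h.1 (i + 1) ⟨_, hl⟩
      simp only [List.get_eq_getElem] at this
      rw [this]
      have e : concat ((List.range (i + 1)).map τ) =
          concat ((List.range i).map τ) ++ ((τ i).head :: (τ i).tail) := by
        simp [concat, List.range_succ]
      simp only [e]
      rw [List.getElem_append_right (by simp [start])]
      simp [start]
  exact ⟨rfl, strictMono_nat_of_lt_succ fun n => by rw [start_succ]; simp, key 0,
    fun i => (key (i + 1)).trans (h.2 i 0)⟩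

end Colors

/-! ### A one-sorted core logic -/

/-- Formulas whose only variables are sequence variables: `lt X Y` says that `X` and `Y` hold at
positions `n < m`, and `meet X Y` says that they hold at a common position. -/
inductive MForm : Type where
  | lt (X Y : ℕ) : MForm
  | meet (X Y : ℕ) : MForm
  | and (φ ψ : MForm) : MForm
  | neg (φ : MForm) : MForm
  | ex (X : ℕ) (φ : MForm) : MForm

/-- All variables of the formula are below `N`. -/
def MForm.Below (N : ℕ) : MForm → Prop
  | .lt X Y => X < N ∧ Y < N
  | .meet X Y => X < N ∧ Y < N
  | .and φ ψ => φ.Below N ∧ ψ.Below N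
  | .neg φ => φ.Below N
  | .ex X φ => X < N ∧ φ.Below N

theorem MForm.Below.mono {M N : ℕ} (h : M ≤ N) : ∀ {φ : MForm}, φ.Below M → φ.Below N
  | .lt _ _, hφ => ⟨hφ.1.trans_le h, hφ.2.trans_le h⟩
  | .meet _ _, hφ => ⟨hφ.1.trans_le h, hφ.2.trans_le h⟩
  | .and _ _, hφ => ⟨hφ.1.mono h, hφ.2.mono h⟩
  | .neg φ, hφ => Below.mono (φ := φ) h hφ
  | .ex _ _, hφ => ⟨hφ.1.trans_le h, hφ.2.mono h⟩

/-- The truth value of a core formula. -/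
def mSat {H : Type u} [Order.Frame H] : (ℕ → HSeq H Bool) → MForm → H
  | J, .lt X Y => ⨆ (n : ℕ) (m : ℕ) (_ : n < m), J X n true ⊓ J Y m true
  | J, .meet X Y => ⨆ n : ℕ, J X n true ⊓ J Y n true
  | J, .and φ ψ => mSat J φ ⊓ mSat J ψ
  | J, .neg φ => (mSat J φ)ᶜ
  | J, .ex X φ => ⨆ β : HSeq H Bool, β.extent ⊓ mSat (Function.update J X β) φ

/-- Truth is extensional at every stage. Both inclusions are assumed because negation exchanges the
roles of `J` and `J'`. -/
theorem inf_mSat_le {H : Type u} [Order.Frame H] {u : H} (φ : MForm) :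
    ∀ {J J' : ℕ → HSeq H Bool}, (∀ X n b, u ⊓ J X n b ≤ J' X n b) →
      (∀ X n b, u ⊓ J' X n b ≤ J X n b) → u ⊓ mSat J φ ≤ mSat J' φ := by
  induction φ with
  | lt X Y =>
    intro J J' h _
    simp only [mSat, inf_iSup_eq, iSup_le_iff]
    refine fun n m hnm => le_iSup_of_le n (le_iSup_of_le m (le_iSup_of_le hnm ?_))
    exact le_inf ((inf_le_inf_left _ inf_le_left).trans (h _ _ _))
      ((inf_le_inf_left _ inf_le_right).trans (h _ _ _))
  | meet X Y =>
    intro J J' h _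
    simp only [mSat, inf_iSup_eq, iSup_le_iff]
    refine fun n => le_iSup_of_le n ?_
    exact le_inf ((inf_le_inf_left _ inf_le_left).trans (h _ _ _))
      ((inf_le_inf_left _ inf_le_right).trans (h _ _ _))
  | and φ ψ ihφ ihψ =>
    intro J J' h h'
    exact le_inf ((inf_le_inf_left _ inf_le_left).trans (ihφ h h'))
      ((inf_le_inf_left _ inf_le_right).trans (ihψ h h'))
  | neg φ ih =>
    intro J J' h h'
    have := ih h' h
    simp only [mSat]
    rw [le_compl_iff_disjoint_right, disjoint_iff_inf_le]
    calc u ⊓ (mSat J φ)ᶜ ⊓ mSat J' φ ≤ (u ⊓ mSat J' φ) ⊓ (mSat J φ)ᶜ := by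
          rw [inf_right_comm]
      _ ≤ mSat J φ ⊓ (mSat J φ)ᶜ := inf_le_inf_right _ this
      _ ≤ ⊥ := inf_compl_self _ |>.le
  | ex X φ ih =>
    intro J J' h h'
    simp only [mSat, inf_iSup_eq, iSup_le_iff]
    refine fun β => le_iSup_of_le β (le_inf (inf_le_right.trans inf_le_left) ?_)
    refine le_trans (inf_le_inf_left _ inf_le_right) (ih ?_ ?_) <;> intro Y n b <;>
    · rcases eq_or_ne Y X with rfl | hY
      · simp
      · simp only [Function.update_of_ne hY]
        first | exact h _ _ _ | exact h' _ _ _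

/-! ### Recognition of core formulas by finite semigroups -/

/-- The letter `a` without the variables from `N` on. -/
def cutoff (N : ℕ) (a : ℕ → Bool) : ℕ → Bool := fun v => decide (v < N) && a v

/-- The word whose letter at position `n` collects the values of the variables below `N`. -/
def word {A : Type v} (N : ℕ) (x : ℕ → (ℕ → A) → ℕ → Bool) (z : ℕ → A) (n : ℕ) : ℕ → Bool :=
  cutoff N fun v => x v z n

theorem word_apply {A : Type v} {N X : ℕ} (hX : X < N) (x : ℕ → (ℕ → A) → ℕ → Bool)
    (z : ℕ → A) (n : ℕ) : word N x z n X = x X z n := by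
  simp [word, cutoff, hX]

theorem word_update {A : Type v} {N X : ℕ} (hX : X < N) (x : ℕ → (ℕ → A) → ℕ → Bool)
    (β : (ℕ → A) → ℕ → Bool) (z : ℕ → A) (n : ℕ) :
    word N (Function.update x X β) z n = Function.update (word N x z n) X (β z n) := by
  funext v
  rcases eq_or_ne v X with rfl | hv
  · simp [word, cutoff, hX]
  · simp [word, cutoff, Function.update_of_ne hv]

/-- The cut-off leaves only finitely many variables in a letter, so one prefix fixes all their
values. -/
theorem cont_word {H : Type u} [Order.Frame H] {A : Type v} {u : H} {ρ : HSeq H A} {N : ℕ}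
    {x : ℕ → (ℕ → A) → ℕ → Bool} (hx : ∀ v, Cont u ρ (x v)) : Cont u ρ (word N x) := by
  intro z hz n
  have h : ∀ᶠ z' in nb u ρ z, ∀ v < N, x v z' n = x v z n :=
    (Filter.eventually_all_finite (Set.finite_lt_nat N)).2 fun v _ => hx v z hz n
  filter_upwards [h] with z' hz'
  funext v
  by_cases hv : v < N
  · simp [word, cutoff, hv, hz' v hv]
  · simp [word, cutoff, hv]

/-- Whenever the word of an interpretation at a stage below RF is cut into a segment of color
`s` and segments of color `e` under `h`, the formula is true if `P s e` and false if not. -/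
def Recognises (H : Type u) [Order.Frame H] (N : ℕ) {Γ : Type} [AddSemigroup Γ]
    (h : (ℕ → Bool) → Γ) (P : Γ → Γ → Prop) (φ : MForm) : Prop :=
  ∀ u : H, u ≤ hRF H → ∀ (A : Type) (ρ : HSeq H A), u ≤ ρ.extent →
    ∀ (J : ℕ → HSeq H Bool) (x : ℕ → (ℕ → A) → ℕ → Bool),
    (∀ v, u ≤ (J v).extent) → (∀ v, Rep u ρ (x v) (J v)) →
    ∀ k : (ℕ → A) → ℕ → ℕ, Cont u ρ k →
    ∀ s e, (∀ z ∈ supp u ρ, Cuts (k z) (fun n => h (word N x z n)) s e) →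
    (P s e → u ≤ mSat J φ) ∧ (¬ P s e → u ⊓ mSat J φ ≤ ⊥)

section Recognition

variable {H : Type u} [Order.Frame H]

/-- RF at work: to bound `u`, one may assume a Ramseyan factorisation of any given sequence over
a finite semigroup. -/
theorem le_of_cuts {u g : H} (hu : u ≤ hRF H) {A : Type} {ρ : HSeq H A} (hρ : u ≤ ρ.extent)
    {Γ : Type} [AddSemigroup Γ] [Finite Γ] {c : (ℕ → A) → ℕ → Γ} (hc : Cont u ρ c)
    (H₁ : ∀ v ≤ u, ∀ (B : Type) (τ : HSeq H B), v ≤ τ.extent →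
      ∀ k : (ℕ → A × B) → ℕ → ℕ, Cont v (zip ρ τ) k → ∀ s e,
      (∀ z ∈ supp v (zip ρ τ), Cuts (k z) (c fun i => (z i).1) s e) → v ≤ g) : u ≤ g := by
  have h₁ : hRF H ≤ (push u ρ c).extent ⇨ ⨆ τ : HSeq H (Str Γ),
      τ.extent ⊓ hIsRamseyanFactorisation (push u ρ c) τ :=
    iInf_le_of_le Γ (iInf_le_of_le inferInstance (iInf_le_of_le inferInstance
      (iInf_le_of_le _ le_rfl)))
  have h₂ := le_trans (le_inf le_rfl (extent_push hρ hc)) (le_himp_iff.1 (hu.trans h₁))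
  refine le_of_forall_inf_le h₂ fun τ => ?_
  -- The stage is refined until the strings `τ 0` and `τ 1` are fixed, so that a single pair of
  -- colors serves all points.
  refine le_of_forall_inf_le ((inf_le_right.trans inf_le_left).trans
    ((HSeq.le_extent_iff.1 le_rfl).1 0)) fun x₀ => ?_
  refine le_of_forall_inf_le ((inf_le_left.trans (inf_le_right.trans inf_le_left)).trans
    ((HSeq.le_extent_iff.1 le_rfl).1 1)) fun x₁ => ?_
  set v := u ⊓ (τ.extent ⊓ hIsRamseyanFactorisation (push u ρ c) τ) ⊓ τ 0 x₀ ⊓ τ 1 x₁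
  have hvu : v ≤ u := inf_le_left.trans (inf_le_left.trans inf_le_left)
  have hvτ : v ≤ τ.extent := inf_le_left.trans (inf_le_left.trans (inf_le_right.trans inf_le_left))
  have hvR : v ≤ hIsRamseyanFactorisation (push u ρ c) τ :=
    inf_le_left.trans (inf_le_left.trans (inf_le_right.trans inf_le_right))
  have hvρ : v ≤ (zip ρ τ).extent := extent_zip (hvu.trans hρ) hvτ
  have hτ : ∀ {z : ℕ → A × Str Γ} {i n : ℕ}, i < n → pre (zip ρ τ) z n ≤ τ i (z i).2 :=
    fun hi => (pre_le hi).trans inf_le_right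
  have hrep := ((rep_push hc).mono hvu).zip_left τ
  refine H₁ v hvu (Str Γ) τ hvτ (fun z => start fun i => (z i).2) ?_ (color x₀) (color x₁) ?_
  · refine fun z hz n => eventually_nb.2 ⟨n, fun z' _ h => ?_⟩
    simp only [start]
    rw [List.map_congr_left fun i hi => by rw [h i (List.mem_range.1 hi)]]
  · intro z hz
    -- Each equation required of a factorisation is forced by some prefix of `z`; since this prefix
    -- is consistent, the equation is true.
    have hR : IsRamseyanFactorisation (c fun i => (z i).1) fun i => (z i).2 := by
      refine ⟨fun k j => ?_, fun i j => ?_⟩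
      · refine hrep.eq_of_inf_le (hvu.trans (extent_push hρ hc)) hz (m := k) ?_
        have h₃ := (hvR.trans inf_le_left).trans
          (iInf_le _ ((List.range k).map fun i => (z i).2))
        refine le_trans (le_trans (le_inf inf_le_left (le_iInf fun i => ?_))
          (le_himp_iff.1 h₃)) (iInf_le _ j)
        have hi : (i : ℕ) < k := by simpa using i.2
        refine inf_le_right.trans ((hτ hi).trans (le_of_eq ?_))
        simp
      · have h₃ := le_iInf_iff.1 (le_iInf_iff.1 (le_iInf_iff.1 (le_iInf_iff.1
          (hvR.trans inf_le_right) i) j) (z (i + 1)).2) (z (j + 1)).2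
        refine of_not_le_bot (hz (i + j + 2)) (le_trans (le_inf inf_le_left ?_)
          (le_himp_iff.1 h₃))
        exact inf_le_right.trans (le_inf (hτ (by omega)) (hτ (by omega)))
    have := cuts_of_isRamseyanFactorisation hR
    have e₀ : (z 0).2 = x₀ := (rep_zip_right v ρ τ).eq_of_inf_le hvτ hz (m := 0) (n := 0)
      (inf_le_left.trans (inf_le_left.trans inf_le_right))
    have e₁ : (z 1).2 = x₁ := (rep_zip_right v ρ τ).eq_of_inf_le hvτ hz (m := 0) (n := 1)
      (inf_le_left.trans inf_le_right)
    simpa only [e₀, e₁] using this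

/-! #### Boolean connectives -/

theorem Recognises.neg {N : ℕ} {Γ : Type} [AddSemigroup Γ] {h : (ℕ → Bool) → Γ}
    {P : Γ → Γ → Prop} {φ : MForm} (hφ : Recognises H N h P φ) :
    Recognises H N h (fun s e => ¬ P s e) φ.neg := by
  intro u hu A ρ hρ J x hJ hx k hk s e hc
  have := hφ u hu A ρ hρ J x hJ hx k hk s e hc
  refine ⟨fun hP => ?_, fun hP => ?_⟩
  · exact le_compl_iff_disjoint_right.2 (disjoint_iff_inf_le.2 (this.2 hP))
  · exact (inf_le_inf_right _ (this.1 (not_not.1 hP))).trans (inf_compl_self _).le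

/-- The projections of the product semigroup are homomorphisms, so the same cuts serve both
conjuncts. -/
theorem Recognises.and {N : ℕ} {Γ Δ : Type} [AddSemigroup Γ] [AddSemigroup Δ]
    {h : (ℕ → Bool) → Γ} {h' : (ℕ → Bool) → Δ} {P : Γ → Γ → Prop} {P' : Δ → Δ → Prop}
    {φ ψ : MForm} (hφ : Recognises H N h P φ) (hψ : Recognises H N h' P' ψ) :
    Recognises H N (fun a => (h a, h' a)) (fun s e => P s.1 e.1 ∧ P' s.2 e.2) (φ.and ψ) := by
  intro u hu A ρ hρ J x hJ hx k hk s e hc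
  have h₁ := hφ u hu A ρ hρ J x hJ hx k hk s.1 e.1 fun z hz =>
    (hc z hz).map (f := Prod.fst) fun _ _ => rfl
  have h₂ := hψ u hu A ρ hρ J x hJ hx k hk s.2 e.2 fun z hz =>
    (hc z hz).map (f := Prod.snd) fun _ _ => rfl
  refine ⟨fun hP => le_inf (h₁.1 hP.1) (h₂.1 hP.2), fun hP => ?_⟩
  rcases not_and_or.1 hP with hP | hP
  · exact (inf_le_inf_left _ inf_le_left).trans (h₁.2 hP)
  · exact (inf_le_inf_left _ inf_le_right).trans (h₂.2 hP)

/-! #### Atoms -/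

/-- A color says whether the first property occurs, whether the second property occurs, and
whether the atomic property holds. -/
@[ext]
structure AtomColor : Type where
  fst : Bool
  snd : Bool
  hit : Bool

namespace AtomColor

instance : AddSemigroup AtomColor where
  add a b := ⟨a.fst || b.fst, a.snd || b.snd, a.hit || b.hit || (a.fst && b.snd)⟩
  add_assoc := by
    rintro ⟨a₁, a₂, a₃⟩ ⟨b₁, b₂, b₃⟩ ⟨c₁, c₂, c₃⟩
    change AtomColor.mk _ _ _ = AtomColor.mk _ _ _
    rw [AtomColor.mk.injEq]
    revert a₁ a₂ a₃ b₁ b₂ b₃ c₁ c₂ c₃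
    decide

instance : Finite AtomColor :=
  Finite.of_injective (fun a : AtomColor => (a.fst, a.snd, a.hit)) fun a b h => by
    simpa [AtomColor.ext_iff] using h

theorem add_def (a b : AtomColor) :
    a + b = ⟨a.fst || b.fst, a.snd || b.snd, a.hit || b.hit || (a.fst && b.snd)⟩ := rfl

/-- Two copies of a segment already produce every hit that more copies could produce. -/
theorem pw_succ (e : AtomColor) (j : ℕ) : pw e (j + 1) = e + e := by
  induction j with
  | zero => rfl
  | succ j ih =>
    rw [pw, ih]
    obtain ⟨a, b, c⟩ := e
    clear ih
    simp only [add_def, AtomColor.mk.injEq]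
    revert a b c
    decide

end AtomColor

/-- The property of words that atomic colors keep track of. -/
def AtomHolds (c : ℕ → AtomColor) (q : ℕ) : Prop :=
  (∃ n < q, (c n).hit = true) ∨ ∃ n m, n < m ∧ m < q ∧ (c n).fst = true ∧ (c m).snd = true

/-- A hit that is new with the last letter needs an earlier occurrence of the first property, so
`fst` is tracked in the same induction. -/
theorem AtomColor.col_spec (c : ℕ → AtomColor) (q : ℕ) :
    ((col c 0 (q + 1)).fst = true ↔ ∃ n < q + 1, (c n).fst = true) ∧
      ((col c 0 (q + 1)).hit = true ↔ AtomHolds c (q + 1)) := by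
  induction q with
  | zero => simp [col_single, AtomHolds]
  | succ q ih =>
    rw [col_succ c (by omega : 0 < q + 1), AtomColor.add_def]
    obtain ⟨h₁, h₂⟩ := ih
    constructor
    · simp only [Bool.or_eq_true, h₁]
      constructor
      · rintro (⟨n, hn, h⟩ | h)
        · exact ⟨n, by omega, h⟩
        · exact ⟨_, by omega, h⟩
      · rintro ⟨n, hn, h⟩
        rcases Nat.lt_succ_iff_lt_or_eq.1 hn with hn | rfl
        · exact Or.inl ⟨n, hn, h⟩
        · exact Or.inr h
    · simp only [Bool.or_eq_true, Bool.and_eq_true, h₁, h₂, AtomHolds]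
      constructor
      · rintro (((⟨n, hn, h⟩ | ⟨n, m, hn, hm, h⟩) | h) | ⟨⟨n, hn, h⟩, h'⟩)
        · exact Or.inl ⟨n, by omega, h⟩
        · exact Or.inr ⟨n, m, hn, by omega, h⟩
        · exact Or.inl ⟨_, by omega, h⟩
        · exact Or.inr ⟨n, _, hn, by omega, h, h'⟩
      · rintro (⟨n, hn, h⟩ | ⟨n, m, hn, hm, h, h'⟩)
        · rcases Nat.lt_succ_iff_lt_or_eq.1 hn with hn | rfl
          · exact Or.inl (Or.inl (Or.inl ⟨n, hn, h⟩))
          · exact Or.inl (Or.inr h)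
        · rcases Nat.lt_succ_iff_lt_or_eq.1 hm with hm | rfl
          · exact Or.inl (Or.inl (Or.inr ⟨n, m, hn, hm, h, h'⟩))
          · exact Or.inr ⟨⟨n, hn, h⟩, h'⟩

/-- The prefixes up to `k 3`, `k 4`, … all have the color `s + (e + e)`, and they exhaust the word.
-/
theorem AtomColor.cuts_spec {k : ℕ → ℕ} {c : ℕ → AtomColor} {s e : AtomColor}
    (h : Cuts k c s e) : (s + (e + e)).hit = true ↔ ∃ q, AtomHolds c q := by
  have key : ∀ j, (s + (e + e)).hit = true ↔ AtomHolds c (k (j + 3)) := by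
    intro j
    have hk : k (j + 3) = k (j + 3) - 1 + 1 := by
      have := h.mono.id_le (j + 3)
      simp only [id] at this
      omega
    rw [hk, ← (AtomColor.col_spec c _).2, ← hk, h.col_head (j + 1), AtomColor.pw_succ]
  constructor
  · exact fun hs => ⟨_, (key 0).1 hs⟩
  · rintro ⟨q, hq⟩
    refine (key q).2 ?_
    have hle : q ≤ k (q + 3) := (Nat.le_add_right q 3).trans (h.mono.id_le (q + 3))
    rcases hq with ⟨n, hn, h⟩ | ⟨n, m, hn, hm, h⟩
    · exact Or.inl ⟨n, by omega, h⟩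
    · exact Or.inr ⟨n, m, hn, by omega, h⟩

/-- If the color hits, each point has witnessing positions, fixed by a prefix, and `le_of_supp`
applies. If not, a stage at which given positions witness the atom has no points, so it is `⊥`. -/
theorem recognises_lt {N X Y : ℕ} (hX : X < N) (hY : Y < N) :
    Recognises H N (fun a => AtomColor.mk (a X) (a Y) false)
      (fun s e => (s + (e + e)).hit = true) (.lt X Y) := by
  intro u hu A ρ hρ J x hJ hx k hk s e hc
  have spec : ∀ z ∈ supp u ρ, ((s + (e + e)).hit = true ↔
      ∃ n m, n < m ∧ x X z n = true ∧ x Y z m = true) := by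
    intro z hz
    rw [AtomColor.cuts_spec (hc z hz)]
    simp only [AtomHolds, word_apply hX, word_apply hY]
    constructor
    · rintro ⟨q, ⟨n, _, h⟩ | ⟨n, m, h, _, h'⟩⟩
      · cases h
      · exact ⟨n, m, h, h'⟩
    · rintro ⟨n, m, h, h'⟩
      exact ⟨m + 1, Or.inr ⟨n, m, h, by omega, h'⟩⟩
  refine ⟨fun hP => le_of_supp hρ fun z hz => ?_, fun hP => ?_⟩
  · obtain ⟨n, m, hnm, h₁, h₂⟩ := (spec z hz).1 hP
    obtain ⟨a, ha⟩ := hx X z hz n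
    obtain ⟨b, hb⟩ := hx Y z hz m
    rw [h₁] at ha
    rw [h₂] at hb
    refine ⟨max a b, le_iSup_of_le n (le_iSup_of_le m (le_iSup_of_le hnm (le_inf ?_ ?_)))⟩
    · exact (inf_le_inf_left _ (pre_anti _ _ (le_max_left _ _))).trans ha
    · exact (inf_le_inf_left _ (pre_anti _ _ (le_max_right _ _))).trans hb
  · simp only [mSat, inf_iSup_eq, iSup_le_iff]
    intro n m hnm
    refine le_of_supp (σ := ρ) (inf_le_left.trans hρ) fun z hz => ?_
    have hz' := supp_mono inf_le_left ρ hz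
    have h₁ := ((hx X).mono inf_le_left).eq_of_inf_le (inf_le_left.trans (hJ X)) hz (m := 0)
      (n := n) (b := true) (inf_le_left.trans (inf_le_right.trans inf_le_left))
    have h₂ := ((hx Y).mono inf_le_left).eq_of_inf_le (inf_le_left.trans (hJ Y)) hz (m := 0)
      (n := m) (b := true) (inf_le_left.trans (inf_le_right.trans inf_le_right))
    exact absurd ((spec z hz').2 ⟨n, m, hnm, h₁, h₂⟩) hP

theorem recognises_meet {N X Y : ℕ} (hX : X < N) (hY : Y < N) :
    Recognises H N (fun a => AtomColor.mk false false (a X && a Y))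
      (fun s e => (s + (e + e)).hit = true) (.meet X Y) := by
  intro u hu A ρ hρ J x hJ hx k hk s e hc
  have spec : ∀ z ∈ supp u ρ, ((s + (e + e)).hit = true ↔
      ∃ n, x X z n = true ∧ x Y z n = true) := by
    intro z hz
    rw [AtomColor.cuts_spec (hc z hz)]
    simp only [AtomHolds, word_apply hX, word_apply hY, Bool.and_eq_true]
    constructor
    · rintro ⟨q, ⟨n, _, h⟩ | ⟨n, m, _, _, h, _⟩⟩
      · exact ⟨n, h⟩
      · cases h
    · rintro ⟨n, h⟩
      exact ⟨n + 1, Or.inl ⟨n, by omega, h⟩⟩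
  refine ⟨fun hP => le_of_supp hρ fun z hz => ?_, fun hP => ?_⟩
  · obtain ⟨n, h₁, h₂⟩ := (spec z hz).1 hP
    obtain ⟨a, ha⟩ := hx X z hz n
    obtain ⟨b, hb⟩ := hx Y z hz n
    rw [h₁] at ha
    rw [h₂] at hb
    refine ⟨max a b, le_iSup_of_le n (le_inf ?_ ?_)⟩
    · exact (inf_le_inf_left _ (pre_anti _ _ (le_max_left _ _))).trans ha
    · exact (inf_le_inf_left _ (pre_anti _ _ (le_max_right _ _))).trans hb
  · simp only [mSat, inf_iSup_eq, iSup_le_iff]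
    intro n
    refine le_of_supp (σ := ρ) (inf_le_left.trans hρ) fun z hz => ?_
    have hz' := supp_mono inf_le_left ρ hz
    have h₁ := ((hx X).mono inf_le_left).eq_of_inf_le (inf_le_left.trans (hJ X)) hz (m := 0)
      (n := n) (b := true) (inf_le_left.trans (inf_le_right.trans inf_le_left))
    have h₂ := ((hx Y).mono inf_le_left).eq_of_inf_le (inf_le_left.trans (hJ Y)) hz (m := 0)
      (n := n) (b := true) (inf_le_left.trans (inf_le_right.trans inf_le_right))
    exact absurd ((spec z hz').2 ⟨n, h₁, h₂⟩) hP

/-! #### Projection -/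

open scoped Pointwise

section Projection

variable {Γ : Type} [AddSemigroup Γ]

/-- The colors of the letters that agree with a given one except at `X`. -/
def projColor (h : (ℕ → Bool) → Γ) (X : ℕ) (a : ℕ → Bool) : Set Γ :=
  Set.range fun b => h (Function.update a X b)

/-- The acceptance condition after projection. -/
def projAcc (P : Γ → Γ → Prop) (S E : Set Γ) : Prop :=
  ∃ j m s e, s ∈ S + pw E j ∧ e ∈ pw E m ∧ P s e

/-- A sum of sets collects the results of independent choices at the letters, and such choices form
a sequence `b`; the induction appends the choice for the last letter. -/
theorem mem_col_projColor (h : (ℕ → Bool) → Γ) (X : ℕ) (y : ℕ → ℕ → Bool) {p q : ℕ}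
    (hpq : p < q) {t : Γ} :
    t ∈ col (fun n => projColor h X (y n)) p q ↔
      ∃ b : ℕ → Bool, col (fun n => h (Function.update (y n) X (b n))) p q = t := by
  induction q, hpq using Nat.le_induction generalizing t with
  | base =>
    simp only [col_single, projColor, Set.mem_range]
    exact ⟨fun ⟨b, hb⟩ => ⟨fun _ => b, hb⟩, fun ⟨b, hb⟩ => ⟨b p, hb⟩⟩
  | succ q hq ih =>
    simp only [col_succ _ hq, Set.mem_add, ih]
    constructor
    · rintro ⟨_, ⟨b, rfl⟩, _, ⟨b', rfl⟩, rfl⟩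
      refine ⟨Function.update b q b', ?_⟩
      rw [Function.update_self]
      congr 1
      exact col_congr hq fun n _ hn => by rw [Function.update_of_ne hn.ne]
    · rintro ⟨b, rfl⟩
      exact ⟨_, ⟨b, rfl⟩, _, ⟨b q, rfl⟩, rfl⟩

/-- A sequence that, inserted at `X`, gives the segment of `y` from `p` to before `q` the color
`t` (if there is one). -/
noncomputable def liftColor (h : (ℕ → Bool) → Γ) (X : ℕ) (y : ℕ → ℕ → Bool) (p q : ℕ) (t : Γ) :
    ℕ → Bool :=
  Classical.epsilon fun b => col (fun n => h (Function.update (y n) X (b n))) p q = t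

/-- A sequence that, inserted at `X`, gives the segments of `y` the colors `s`, `e`, `e`, …. -/
noncomputable def liftCuts (h : (ℕ → Bool) → Γ) (X : ℕ) (s e : Γ) (y : ℕ → ℕ → Bool)
    (k : ℕ → ℕ) (n : ℕ) : Bool :=
  let i := Nat.findGreatest (fun i => k i ≤ n) n
  -- Blanking `y` after the segment makes the chosen witness depend on a finite part of `y` only,
  -- which is needed for continuity.
  liftColor h X (fun j => if j < k (i + 1) then y j else fun _ => false) (k i) (k (i + 1))
    (if i = 0 then s else e) n

/-- The search bound `n` suffices because `i ≤ k i ≤ n`. -/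
theorem findGreatest_cuts {k : ℕ → ℕ} (hk : StrictMono k) {i n : ℕ} (h₁ : k i ≤ n)
    (h₂ : n < k (i + 1)) : Nat.findGreatest (fun i => k i ≤ n) n = i := by
  rw [Nat.findGreatest_eq_iff]
  refine ⟨(hk.id_le i).trans h₁, fun _ => h₁, fun j hj _ h => ?_⟩
  exact absurd (hk.monotone (Nat.succ_le_of_lt hj)) (by simp only [Nat.succ_eq_add_one]; omega)

/-- The desired color of each segment lies in its set color, so `mem_col_projColor` gives a witness
there; witnesses of different segments do not interfere, as a segment's color depends on its own
letters only. -/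
theorem cuts_liftCuts (h : (ℕ → Bool) → Γ) (X : ℕ) {S E : Set Γ} {s e : Γ} (hs : s ∈ S)
    (he : e ∈ E) {y : ℕ → ℕ → Bool} {k : ℕ → ℕ}
    (hk : Cuts k (fun n => projColor h X (y n)) S E) :
    Cuts k (fun n => h (Function.update (y n) X (liftCuts h X s e y k n))) s e := by
  have key : ∀ i, (if i = 0 then s else e) ∈
      col (fun n => projColor h X (y n)) (k i) (k (i + 1)) →
      col (fun n => h (Function.update (y n) X (liftCuts h X s e y k n))) (k i) (k (i + 1)) =
        if i = 0 then s else e := by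
    intro i hi
    have hki := hk.mono i.lt_succ_self
    obtain ⟨b, hb⟩ := (mem_col_projColor h X y hki).1 hi
    let y' : ℕ → ℕ → Bool := fun j => if j < k (i + 1) then y j else fun _ => false
    have hb' : ∃ b : ℕ → Bool, col (fun n => h (Function.update (y' n) X (b n)))
        (k i) (k (i + 1)) = if i = 0 then s else e := by
      refine ⟨b, hb ▸ col_congr hki fun n _ hn => ?_⟩
      simp only [y', if_pos hn]
    refine (col_congr hki fun n h₁ h₂ => ?_).trans (Classical.epsilon_spec hb')
    have : liftCuts h X s e y k n = liftColor h X y' (k i) (k (i + 1))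
        (if i = 0 then s else e) n := by
      simp only [liftCuts, findGreatest_cuts hk.mono h₁ h₂, y']
    rw [this]
    simp only [y', if_pos h₂]
    rfl
  refine ⟨hk.zero, hk.mono, ?_, fun i => ?_⟩
  · simpa using key 0 (by simpa [hk.head] using hs)
  · simpa using key (i + 1) (by simpa [hk.tail] using he)

/-- Position `n` lies in a segment of index at most `n`, which ends no later than `k (n + 1)`. -/
theorem liftCuts_congr (h : (ℕ → Bool) → Γ) (X : ℕ) (s e : Γ) {y y' : ℕ → ℕ → Bool}
    {k k' : ℕ → ℕ} (hk : StrictMono k) {n : ℕ} (hkk : ∀ i < n + 2, k' i = k i)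
    (hy : ∀ j < k (n + 1), y' j = y j) : liftCuts h X s e y' k' n = liftCuts h X s e y k n := by
  have hi : Nat.findGreatest (fun i => k' i ≤ n) n = Nat.findGreatest (fun i => k i ≤ n) n := by
    have h1 := Nat.findGreatest_le (P := fun i => k i ≤ n) n
    rw [Nat.findGreatest_eq_iff]
    refine ⟨h1, fun h0 => ?_, fun j hj hjn => ?_⟩
    · rw [hkk _ (by omega)]
      exact Nat.findGreatest_of_ne_zero (P := fun i => k i ≤ n) rfl h0
    · rw [hkk _ (by omega)]
      exact Nat.findGreatest_is_greatest (P := fun i => k i ≤ n) hj hjn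
  simp only [liftCuts, hi]
  have hin := Nat.findGreatest_le (P := fun i => k i ≤ n) n
  generalize Nat.findGreatest (fun i => k i ≤ n) n = i at hin
  rw [hkk i (by omega), hkk (i + 1) (by omega)]
  congr 1
  funext j
  split_ifs with hj
  · exact hy j (hj.trans_le (hk.monotone (by omega)))
  · rfl

/-- If `projAcc` holds, the segments are regrouped into blocks whose set colors contain `s` and `e`,
and a witness is chosen block by block; it depends continuously on the point, so `push` makes it a
sequence. If `projAcc` fails, RF is applied to the colors of the segments with a putative witness
inserted. The coarser cuts have colors realised within `S` and `E`, hence not in `P`, and the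
hypothesis on `φ` refutes the witness. -/
theorem Recognises.ex [Finite Γ] {N : ℕ} {h : (ℕ → Bool) → Γ} {P : Γ → Γ → Prop} {φ : MForm}
    (hφ : Recognises H N h P φ) {X : ℕ} (hX : X < N) :
    Recognises H N (projColor h X) (projAcc P) (φ.ex X) := by
  intro u hu A ρ hρ J x hJ hx k hk S E hc
  have hxc : ∀ v, Cont u ρ (x v) := fun v => (hx v).cont (hJ v)
  constructor
  · rintro ⟨j, m, s, e, hs, he, hP⟩
    -- The new head takes `j + 2` segments, for color `S + pw E j`; each later block takes `m + 1`
    -- segments, for color `pw E m`.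
    let k' : (ℕ → A) → ℕ → ℕ := fun z i => if i = 0 then 0 else k z (j + 2 + (m + 1) * (i - 1))
    have hk' : Cont u ρ k' := by
      intro z hz n
      by_cases hn : n = 0
      · simp [k', hn]
      · simpa only [k', if_neg hn] using hk z hz _
    have hcuts : ∀ z ∈ supp u ρ, Cuts (k' z) (fun n => projColor h X (word N x z n))
        (S + pw E j) (pw E m) := by
      intro z hz
      have hcz := hc z hz
      refine ⟨rfl, strictMono_nat_of_lt_succ fun n => ?_, ?_, fun i => ?_⟩
      · rcases n with _ | n
        · simp only [k', if_pos, Nat.add_one_ne_zero, if_false]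
          exact lt_of_eq_of_lt hcz.zero.symm (hcz.mono (by omega))
        · simp only [k', Nat.add_one_ne_zero, if_false, Nat.add_sub_cancel]
          exact hcz.mono (by rw [Nat.mul_succ]; omega)
      · simpa [k'] using hcz.col_head j
      · have := hcz.col_tail (i := j + 2 + (m + 1) * i) (by omega) m
        simp only [k', Nat.add_one_ne_zero, if_false, Nat.add_sub_cancel]
        rw [← this]
        congr 2
        simp only [Nat.add_one_sub_one, Nat.mul_succ]
        omega
    let β : (ℕ → A) → ℕ → Bool := fun z => liftCuts h X s e (word N x z) (k' z)
    have hβ : Cont u ρ β := by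
      intro z hz n
      filter_upwards [hk'.eventually_lt hz (n + 2),
        (cont_word (N := N) hxc).eventually_lt hz (k' z (n + 1))] with z' h₁ h₂
      exact liftCuts_congr h X s e (hcuts z hz).mono h₁ h₂
    refine le_iSup_of_le (push u ρ β) (le_inf (extent_push hρ hβ) ?_)
    refine (hφ u hu A ρ hρ (Function.update J X (push u ρ β)) (Function.update x X β)
      (fun v => ?_) (fun v => ?_) k' hk' s e fun z hz => ?_).1 hP
    · rcases eq_or_ne v X with rfl | hv
      · simpa using extent_push hρ hβ
      · simpa [Function.update_of_ne hv] using hJ v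
    · rcases eq_or_ne v X with rfl | hv
      · simpa using rep_push hβ
      · simpa [Function.update_of_ne hv] using hx v
    · simp only [word_update hX]
      exact cuts_liftCuts h X hs he (hcuts z hz)
  · intro hP
    simp only [mSat, inf_iSup_eq, iSup_le_iff]
    intro β
    set v := u ⊓ (β.extent ⊓ mSat (Function.update J X β) φ)
    have hvu : v ≤ u := inf_le_left
    have hvβ : v ≤ β.extent := inf_le_right.trans inf_le_left
    have hvρ : v ≤ (zip ρ β).extent := extent_zip (hvu.trans hρ) hvβ
    let J' := Function.update J X β
    let x' : ℕ → (ℕ → A × Bool) → ℕ → Bool :=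
      Function.update (fun w z => x w fun i => (z i).1) X fun z i => (z i).2
    have hJ' : ∀ w, v ≤ (J' w).extent := by
      intro w
      rcases eq_or_ne w X with rfl | hw
      · simpa [J'] using hvβ
      · simpa [J', Function.update_of_ne hw] using hvu.trans (hJ w)
    have hx' : ∀ w, Rep v (zip ρ β) (x' w) (J' w) := by
      intro w
      rcases eq_or_ne w X with rfl | hw
      · simpa [J', x'] using rep_zip_right v ρ β
      · simpa [J', x', Function.update_of_ne hw] using ((hx w).mono hvu).zip_left β
    have hy' := cont_word (N := N) fun w => (hx' w).cont (hJ' w)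
    have hk' := (hk.mono hvu).zip_left β
    have hword : ∀ z n, word N x' z n =
        Function.update (word N x (fun i => (z i).1) n) X (z n).2 := fun z n =>
      word_update hX (fun w z => x w fun i => (z i).1) (fun z i => (z i).2) z n
    let c : (ℕ → A × Bool) → ℕ → Γ := fun z i => col (fun n => h (word N x' z n))
      (k (fun i => (z i).1) i) (k (fun i => (z i).1) (i + 1))
    have hcz : ∀ z ∈ supp v (zip ρ β), Cuts (k fun i => (z i).1)
        (fun n => projColor h X (word N x (fun i => (z i).1) n)) S E :=
      fun z hz => hc _ (supp_mono hvu ρ (supp_zip_left hz))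
    have hcc : Cont v (zip ρ β) c := by
      intro z hz i
      filter_upwards [hk' z hz i, hk' z hz (i + 1),
        hy'.eventually_lt hz (k (fun i => (z i).1) (i + 1))] with z' h₁ h₂ h₃
      simp only [c]
      rw [h₁, h₂]
      exact col_congr ((hcz z hz).mono i.lt_succ_self) fun n _ hn => by rw [h₃ n hn]
    refine le_of_cuts (hvu.trans hu) hvρ hcc fun w hw B τ hτ l hl s e hs => ?_
    by_contra hbot
    have hwζ : w ≤ (zip (zip ρ β) τ).extent := extent_zip (hw.trans hvρ) hτ
    -- The first two strings are merged: a head of color in `S + pw E j` consists of at least two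
    -- segments, and `l z 2 ≥ 2` while `l z 1` may be `1`.
    let k₁ : (ℕ → (A × Bool) × B) → ℕ → ℕ := fun z i =>
      k (fun n => (z n).1.1) (if i = 0 then 0 else l z (i + 1))
    have hcuts : ∀ z ∈ supp w (zip (zip ρ β) τ),
        Cuts (k₁ z) (fun n => h (word N x' (fun n => (z n).1) n)) (s + e) e := by
      intro z hz
      have h₁ := hcz _ (supp_mono hw _ (supp_zip_left hz))
      have h₂ := hs z hz
      refine ⟨?_, strictMono_nat_of_lt_succ fun n => ?_, ?_, fun i => ?_⟩
      · simpa [k₁] using h₁.zero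
      · refine h₁.mono ?_
        rcases n with _ | n
        · simpa [h₂.zero] using h₂.mono (by omega : 0 < 2)
        · simpa using h₂.mono (by omega : n + 1 + 1 < n + 1 + 1 + 1)
      · have := h₂.col_head 0
        rw [col_blocks _ h₁.mono (lt_of_eq_of_lt h₂.zero.symm (h₂.mono (by omega)))] at this
        simpa [k₁, pw] using this
      · have := h₂.tail (i + 1)
        rw [col_blocks _ h₁.mono (h₂.mono (by omega))] at this
        simpa [k₁] using this
    have hk₁ : Cont w (zip (zip ρ β) τ) k₁ := by
      intro z hz i
      have hkc := (hk'.mono hw).zip_left τ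
      rcases eq_or_ne i 0 with rfl | hi
      · simpa [k₁] using hkc z hz 0
      · filter_upwards [hl z hz (i + 1), hkc z hz (l z (i + 1))] with z' h₁ h₂
        simp only [k₁, if_neg hi]
        rw [h₁, h₂]
    have hnP : ¬ P (s + e) e := by
      -- The colors are the same at all points, so one point suffices; it exists because `w` is not
      -- `⊥`.
      obtain ⟨z, hz⟩ := exists_point hwζ hbot
      have h₁ := hcz _ (supp_mono hw _ (supp_zip_left hz))
      have h₂ := hs z hz
      have h₃ := hcuts z hz
      have mem : ∀ {p q : ℕ}, p < q → col (fun n => h (word N x' (fun n => (z n).1) n)) p q ∈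
          col (fun n => projColor h X (word N x (fun n => (z n).1.1) n)) p q := fun hpq =>
        (mem_col_projColor h X _ hpq).2 ⟨fun n => (z n).1.2, by simp only [hword]⟩
      refine fun hPs => hP ⟨l z 2 - 2, l z 3 - l z 2 - 1, s + e, e, ?_, ?_, hPs⟩
      · have h2 : 2 ≤ l z 2 := h₂.mono.id_le 2
        rw [← h₁.col_head, ← h₃.head, h₃.zero]
        have e₁ : k₁ z 1 = k (fun n => (z n).1.1) (l z 2 - 2 + 2) := by
          simp [k₁, Nat.sub_add_cancel h2]
        rw [e₁]
        exact mem (lt_of_eq_of_lt h₁.zero.symm (h₁.mono (by omega)))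
      · have h2 : 2 ≤ l z 2 := h₂.mono.id_le 2
        have h3 : l z 2 < l z 3 := h₂.mono (by omega)
        rw [← h₁.col_tail (i := l z 2) (by omega), ← h₃.tail 0]
        have e₁ : l z 2 + (l z 3 - l z 2 - 1) + 1 = l z 3 := by omega
        rw [e₁]
        have := mem (h₁.mono h3)
        simpa [k₁] using this
    refine hbot (le_trans (le_inf le_rfl (hw.trans (inf_le_right.trans inf_le_right))) ((hφ w
      ((hw.trans hvu).trans hu) _ (zip (zip ρ β) τ) hwζ J' (fun a z => x' a fun n => (z n).1)
      (fun a => hw.trans (hJ' a)) (fun a => ((hx' a).mono hw).zip_left τ) k₁ hk₁ (s + e) e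
      hcuts).2 hnP))

end Projection

end Recognition

/-! ### Translation into the core logic -/

/-- The core formula "`X` holds at exactly one position". -/
def sing (X : ℕ) : MForm := .and (.meet X X) (.neg (.lt X X))

/-- The translation of formulas into the core logic. -/
def Form.tr {V₁ : Type v} {V₂ : Type w} (e₁ : V₁ ↪ ℕ) (e₂ : V₂ ↪ ℕ) : Form V₁ V₂ → MForm
  | .lt x y => .lt (2 * e₁ x) (2 * e₁ y)
  | .mem x X => .meet (2 * e₁ x) (2 * e₂ X + 1)
  | .and φ ψ => .and (φ.tr e₁ e₂) (ψ.tr e₁ e₂)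
  | .neg φ => .neg (φ.tr e₁ e₂)
  | .exFst x φ => .ex (2 * e₁ x) (.and (sing (2 * e₁ x)) (φ.tr e₁ e₂))
  | .exSnd X φ => .ex (2 * e₂ X + 1) (φ.tr e₁ e₂)

/-- A bound in terms of the code alone lets `decideSat` choose the number of bits of a letter. -/
theorem Form.below_tr {V₁ : Type v} {V₂ : Type w} (e₁ : V₁ ↪ ℕ) (e₂ : V₂ ↪ ℕ)
    (φ : Form V₁ V₂) : (φ.tr e₁ e₂).Below (2 * φ.code e₁ e₂ + 2) := by
  induction φ with
  | lt x y =>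
    have h₁ := Nat.left_le_pair (e₁ x) (e₁ y)
    have h₂ := Nat.right_le_pair (e₁ x) (e₁ y)
    simp only [tr, MForm.Below, code]
    omega
  | mem x X =>
    have h₁ := Nat.left_le_pair (e₁ x) (e₂ X)
    have h₂ := Nat.right_le_pair (e₁ x) (e₂ X)
    simp only [tr, MForm.Below, code]
    omega
  | and φ ψ ihφ ihψ =>
    have h₁ := Nat.left_le_pair (φ.code e₁ e₂) (ψ.code e₁ e₂)
    have h₂ := Nat.right_le_pair (φ.code e₁ e₂) (ψ.code e₁ e₂)
    simp only [tr, MForm.Below, code]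
    exact ⟨ihφ.mono (by omega), ihψ.mono (by omega)⟩
  | neg φ ih =>
    simp only [tr, MForm.Below, code]
    exact ih.mono (by omega)
  | exFst x φ ih =>
    have h₁ := Nat.left_le_pair (e₁ x) (φ.code e₁ e₂)
    have h₂ := Nat.right_le_pair (e₁ x) (φ.code e₁ e₂)
    simp only [tr, sing, MForm.Below, code]
    exact ⟨by omega, by omega, ih.mono (by omega)⟩
  | exSnd X φ ih =>
    have h₁ := Nat.left_le_pair (e₂ X) (φ.code e₁ e₂)
    have h₂ := Nat.right_le_pair (e₂ X) (φ.code e₁ e₂)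
    simp only [tr, MForm.Below, code]
    exact ⟨by omega, ih.mono (by omega)⟩

/-- The formula with the variables `ks` quantified, where even numbers stand for first-order
variables. -/
def closure (ks : List ℕ) (φ : MForm) : MForm :=
  ks.foldr (fun k ψ => .ex k (if k % 2 = 0 then .and (sing k) ψ else ψ)) φ

theorem below_closure {N : ℕ} {ks : List ℕ} (hks : ∀ k ∈ ks, k < N) {φ : MForm}
    (hφ : φ.Below N) : (closure ks φ).Below N := by
  induction ks with
  | nil => exact hφ
  | cons k ks ih =>
    have hk := hks k (by simp)
    have := ih fun k hk => hks k (by simp [hk])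
    simp only [closure, List.foldr_cons, MForm.Below] at this ⊢
    split_ifs <;> simp only [sing, MForm.Below] <;> tauto

section

variable {H : Type u} [Order.Frame H]

/-- The sequence that corresponds to a sequence of the metatheory. -/
def const {A : Type v} (a : ℕ → A) : HSeq H A := fun n b => truth H (b = a n)

theorem extent_const {A : Type v} (a : ℕ → A) : (const a : HSeq H A).extent = ⊤ := by
  rw [← top_le_iff, HSeq.le_extent_iff]
  refine ⟨fun n => le_iSup_of_le (a n) (truth_of rfl).ge, fun n b c => ?_⟩
  by_cases hb : b = a n
  · by_cases hc : c = a n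
    · rw [truth_of (hb.trans hc.symm)]; exact le_top
    · rw [const, const, truth_of_not hc]; simp
  · rw [const, const, truth_of_not hb]; simp

/-- The characteristic sequence of a singleton. -/
def single (n : ℕ) : HSeq H Bool := const fun m => decide (m = n)

theorem single_true (n m : ℕ) : (single n : HSeq H Bool) m true = truth H (m = n) := by
  simp [single, const]

theorem extent_single (n : ℕ) : (single n : HSeq H Bool).extent = ⊤ := extent_const _

theorem mSat_sing {J : ℕ → HSeq H Bool} {X n : ℕ} (h : J X = single n) :
    mSat J (sing X) = ⊤ := by
  rw [← top_le_iff]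
  refine le_inf (le_iSup_of_le n ?_) ?_
  · rw [h, single_true, truth_of rfl, top_inf_eq]
  · refine le_compl_iff_disjoint_right.2 (disjoint_iff_inf_le.2 (inf_le_right.trans ?_))
    simp only [mSat, iSup_le_iff, h, single_true]
    intro a b hab
    by_cases ha : a = n
    · rw [truth_of_not (by omega : ¬ b = n)]; simp
    · rw [truth_of_not ha]; simp

/-- The stage is covered by stages at which some number `n` is in `J X`. There no other position can
hold, since two positions would satisfy `lt X X`, and totality makes the others false. -/
theorem le_of_sing {J : ℕ → HSeq H Bool} {X : ℕ} {u g : H} (hX : u ≤ (J X).extent)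
    (hu : u ≤ mSat J (sing X))
    (h : ∀ n, ∀ v ≤ u, (∀ m b, v ⊓ J X m b ≤ single n m b) →
      (∀ m b, v ⊓ single n m b ≤ J X m b) → v ≤ g) : u ≤ g := by
  refine le_of_forall_inf_le (hu.trans inf_le_left) fun n => ?_
  set v := u ⊓ (J X n true ⊓ J X n true)
  have hv : v ≤ J X n true := inf_le_right.trans inf_le_left
  have hvu : v ≤ u := inf_le_left
  obtain ⟨tot, func⟩ := HSeq.le_extent_iff.1 (hvu.trans hX)
  have hn : v ⊓ J X n false ≤ ⊥ := by
    refine le_trans (le_inf inf_le_left (le_inf (inf_le_left.trans hv) inf_le_right))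
      ((func n true false).trans ?_)
    rw [truth_of_not (by simp)]
  have hm : ∀ m, m ≠ n → v ⊓ J X m true ≤ ⊥ := by
    intro m hmn
    have hlt : v ⊓ mSat J (.lt X X) ≤ ⊥ :=
      disjoint_iff_inf_le.1 (le_compl_iff_disjoint_right.1 (hvu.trans (hu.trans inf_le_right)))
    refine le_trans (le_inf inf_le_left ?_) hlt
    rcases lt_or_gt_of_ne hmn with hmn | hmn
    · exact le_iSup_of_le m (le_iSup_of_le n (le_iSup_of_le hmn
        (le_inf inf_le_right (inf_le_left.trans hv))))
    · exact le_iSup_of_le n (le_iSup_of_le m (le_iSup_of_le hmn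
        (le_inf (inf_le_left.trans hv) inf_le_right)))
  refine h n v hvu (fun m b => ?_) fun m b => ?_
  · by_cases hb : b = decide (m = n)
    · rw [single, const, truth_of hb]; exact le_top
    · refine le_trans ?_ bot_le
      rcases eq_or_ne m n with rfl | hmn
      · cases b <;> simp at hb
        exact hn
      · cases b <;> simp [hmn] at hb
        exact hm m hmn
  · by_cases hb : b = decide (m = n)
    · rcases eq_or_ne m n with rfl | hmn
      · simp only [decide_true] at hb
        subst hb
        exact inf_le_left.trans hv
      · simp only [hmn, decide_false] at hb
        subst hb
        refine inf_le_left.trans (le_of_forall_inf_le (tot m) fun b => ?_)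
        cases b
        · exact inf_le_right
        · exact (hm m hmn).trans bot_le
    · rw [single, const, truth_of_not hb]; simp

theorem inf_mSat_update_le {J : ℕ → HSeq H Bool} {X : ℕ} {β γ : HSeq H Bool} {u : H}
    (h₁ : ∀ m b, u ⊓ β m b ≤ γ m b) (h₂ : ∀ m b, u ⊓ γ m b ≤ β m b) (φ : MForm) :
    u ⊓ mSat (Function.update J X β) φ ≤ mSat (Function.update J X γ) φ := by
  refine inf_mSat_le φ ?_ ?_ <;> intro Y n b <;>
  · rcases eq_or_ne Y X with rfl | hY
    · simp only [Function.update_self]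
      first | exact h₁ n b | exact h₂ n b
    · simp [Function.update_of_ne hY]

theorem mSat_congr {N : ℕ} {φ : MForm} (hφ : φ.Below N) {J J' : ℕ → HSeq H Bool}
    (h : ∀ k < N, J k = J' k) : mSat J φ = mSat J' φ := by
  induction φ generalizing J J' with
  | lt X Y => simp only [mSat, h X hφ.1, h Y hφ.2]
  | meet X Y => simp only [mSat, h X hφ.1, h Y hφ.2]
  | and φ ψ ihφ ihψ => simp only [mSat, ihφ hφ.1 h, ihψ hφ.2 h]
  | neg φ ih => rw [mSat, mSat, ih hφ h]
  | ex X φ ih =>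
    simp only [mSat]
    refine iSup_congr fun β => ?_
    rw [ih hφ.2 fun k hk => ?_]
    rcases eq_or_ne k X with rfl | hkX
    · simp
    · simp [Function.update_of_ne hkX, h k hk]

section Translation

variable {V₁ : Type v} {V₂ : Type w}

/-- The core interpretation given by an interpretation. -/
noncomputable def HInterp.toCore (e₁ : V₁ ↪ ℕ) (e₂ : V₂ ↪ ℕ) (I : HInterp H V₁ V₂) (k : ℕ) :
    HSeq H Bool :=
  if k % 2 = 0 then single (Function.extend e₁ I.fst (fun _ => 0) (k / 2))
  else Function.extend e₂ I.snd (fun _ => const fun _ => false) (k / 2)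

theorem HInterp.extent_le_toCore (e₁ : V₁ ↪ ℕ) (e₂ : V₂ ↪ ℕ) (I : HInterp H V₁ V₂) (k : ℕ) :
    I.extent ≤ (I.toCore e₁ e₂ k).extent := by
  rw [toCore]
  split_ifs
  · rw [extent_single]; exact le_top
  · by_cases h : ∃ X, e₂ X = k / 2
    · obtain ⟨X, hX⟩ := h
      rw [← hX, e₂.injective.extend_apply]
      exact iInf_le _ X
    · rw [Function.extend_apply' _ _ _ h, extent_const]; exact le_top

variable [DecidableEq V₁] [DecidableEq V₂]

/-- In the case of a first-order quantifier, an `H`-valued singleton need not be the singleton of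
one number, but by `le_of_sing` it is so on a cover. -/
theorem hSatisfies_eq_mSat (e₁ : V₁ ↪ ℕ) (e₂ : V₂ ↪ ℕ) (φ : Form V₁ V₂) :
    ∀ {I : HInterp H V₁ V₂} {J : ℕ → HSeq H Bool}, (∀ x, J (2 * e₁ x) = single (I.fst x)) →
      (∀ X, J (2 * e₂ X + 1) = I.snd X) → hSatisfies I φ = mSat J (φ.tr e₁ e₂) := by
  induction φ with
  | lt x y =>
    intro I J h₁ h₂
    simp only [hSatisfies, Form.tr, mSat, h₁, single_true]
    apply le_antisymm
    · refine iSup_le fun h => le_iSup_of_le _ (le_iSup_of_le _ (le_iSup_of_le h ?_))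
      rw [truth_of rfl, truth_of rfl, top_inf_eq]
    · simp only [iSup_le_iff]
      intro n m hnm
      by_cases hn : n = I.fst x
      · by_cases hm : m = I.fst y
        · rw [truth_of (hn ▸ hm ▸ hnm : I.fst x < I.fst y)]; exact le_top
        · rw [truth_of_not hm]; simp
      · rw [truth_of_not hn]; simp
  | mem x X =>
    intro I J h₁ h₂
    simp only [hSatisfies, Form.tr, mSat, h₁, h₂, single_true]
    apply le_antisymm
    · refine le_iSup_of_le (I.fst x) ?_
      rw [truth_of rfl, top_inf_eq]
    · refine iSup_le fun n => ?_
      by_cases hn : n = I.fst x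
      · rw [hn]; exact inf_le_right
      · rw [truth_of_not hn]; simp
  | and φ ψ ihφ ihψ =>
    intro I J h₁ h₂
    simp only [hSatisfies, Form.tr, mSat, ihφ h₁ h₂, ihψ h₁ h₂]
  | neg φ ih =>
    intro I J h₁ h₂
    simp only [hSatisfies, Form.tr, mSat, ih h₁ h₂]
  | exFst x φ ih =>
    intro I J h₁ h₂
    have ih' : ∀ n, hSatisfies ⟨Function.update I.fst x n, I.snd⟩ φ =
        mSat (Function.update J (2 * e₁ x) (single n)) (φ.tr e₁ e₂) := by
      refine fun n => ih (fun y => ?_) fun X => ?_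
      · rcases eq_or_ne y x with rfl | hy
        · simp
        · rw [Function.update_of_ne fun h => hy (e₁.injective (by omega)), h₁]
          simp [Function.update_of_ne hy]
      · rw [Function.update_of_ne (by omega), h₂]
    simp only [hSatisfies, Form.tr, mSat, ih']
    apply le_antisymm
    · refine iSup_le fun n => le_iSup_of_le (single n) ?_
      rw [extent_single, top_inf_eq, mSat_sing (n := n) (by simp), top_inf_eq]
    · refine iSup_le fun β => ?_
      refine le_of_sing (J := Function.update J (2 * e₁ x) β) (X := 2 * e₁ x)
        (by simp) (inf_le_right.trans inf_le_left) fun n v hv hβ hβ' => ?_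
      simp only [Function.update_self] at hβ hβ'
      refine le_iSup_of_le n (le_trans (le_inf le_rfl ?_) (inf_mSat_update_le hβ hβ' _))
      exact hv.trans (inf_le_right.trans inf_le_right)
  | exSnd X φ ih =>
    intro I J h₁ h₂
    have ih' : ∀ β, hSatisfies ⟨I.fst, Function.update I.snd X β⟩ φ =
        mSat (Function.update J (2 * e₂ X + 1) β) (φ.tr e₁ e₂) := by
      refine fun β => ih (fun y => ?_) fun Y => ?_
      · rw [Function.update_of_ne (by omega), h₁]
      · rcases eq_or_ne Y X with rfl | hY
        · simp
        · rw [Function.update_of_ne fun h => hY (e₂.injective (by omega)), h₂]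
          simp [Function.update_of_ne hY]
    simp only [hSatisfies, Form.tr, mSat, ih']

theorem hSatisfies_eq_mSat_toCore (e₁ : V₁ ↪ ℕ) (e₂ : V₂ ↪ ℕ) (I : HInterp H V₁ V₂)
    (φ : Form V₁ V₂) : hSatisfies I φ = mSat (I.toCore e₁ e₂) (φ.tr e₁ e₂) := by
  refine hSatisfies_eq_mSat e₁ e₂ φ (fun x => ?_) fun X => ?_
  · simp [HInterp.toCore, e₁.injective.extend_apply]
  · have : (2 * e₂ X + 1) / 2 = e₂ X := by omega
    simp [HInterp.toCore, this, e₂.injective.extend_apply]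

/-- The witness for each quantifier is the value of `J`; instantiating it removes one variable from
those where `J` and `J'` may differ. -/
theorem mSat_le_closure {J J' : ℕ → HSeq H Bool} {u : H} (hJ : ∀ k, u ≤ (J k).extent)
    {ks : List ℕ} (hs : ∀ k ∈ ks, k % 2 = 0 → ∃ n, J k = single n)
    (hJJ' : ∀ k, k ∉ ks → J' k = J k) (φ : MForm) :
    u ⊓ mSat J φ ≤ mSat J' (closure ks φ) := by
  induction ks generalizing J' with
  | nil =>
    obtain rfl : J' = J := funext fun k => hJJ' k (by simp)
    exact inf_le_right
  | cons k ks ih =>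
    have := ih (J' := Function.update J' k (J k)) (fun k hk => hs k (by simp [hk])) fun l hl => by
      rcases eq_or_ne l k with rfl | hlk
      · simp
      · rw [Function.update_of_ne hlk, hJJ' l (by simp [hl, hlk])]
    refine le_iSup_of_le (J k) (le_inf (inf_le_left.trans (hJ k)) ?_)
    split_ifs with hk
    · obtain ⟨n, hn⟩ := hs k (by simp) hk
      refine le_inf ?_ this
      rw [mSat_sing (n := n) (by simp [hn])]
      exact le_top
    · exact this

/-- `J` collects witnesses while quantifiers are peeled off. The stage shrinks at each first-order
variable, as an interpretation assigns actual numbers to these. -/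
theorem closure_le_hSatisfiable (e₁ : V₁ ↪ ℕ) (e₂ : V₂ ↪ ℕ) {φ : Form V₁ V₂} {N : ℕ}
    (hN : (φ.tr e₁ e₂).Below N) (ks : List ℕ) {J : ℕ → HSeq H Bool} {u : H}
    (hJ : ∀ k, u ≤ (J k).extent)
    (hs : ∀ k < N, k % 2 = 0 → k ∉ ks → ∃ n, J k = single n) :
    u ⊓ mSat J (closure ks (φ.tr e₁ e₂)) ≤ hSatisfiable H φ := by
  induction ks generalizing J u with
  | nil =>
    have : ∀ k, ∃ n, k < N → k % 2 = 0 → J k = single n := by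
      intro k
      by_cases hk : k < N ∧ k % 2 = 0
      · obtain ⟨n, hn⟩ := hs k hk.1 hk.2 (by simp)
        exact ⟨n, fun _ _ => hn⟩
      · exact ⟨0, fun h h' => absurd ⟨h, h'⟩ hk⟩
    choose n hn using this
    let I : HInterp H V₁ V₂ := ⟨fun x => n (2 * e₁ x), fun X => J (2 * e₂ X + 1)⟩
    have hI : hSatisfies I φ = mSat (fun k => if k % 2 = 0 then single (n k) else J k)
        (φ.tr e₁ e₂) :=
      hSatisfies_eq_mSat e₁ e₂ φ (fun x => by simp [I]) fun X => by
        simp [I, Nat.add_mod]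
    refine le_iSup_of_le I (le_inf (inf_le_left.trans (le_iInf fun X => hJ _)) ?_)
    rw [hI, mSat_congr hN (J' := J) fun k hk => ?_]
    · exact inf_le_right
    · split_ifs with h
      · exact (hn k hk h).symm
      · rfl
  | cons k ks ih =>
    simp only [closure, List.foldr_cons, mSat, inf_iSup_eq, iSup_le_iff]
    intro β
    have ext : ∀ {v : H} {γ : HSeq H Bool}, v ≤ u → v ≤ γ.extent →
        ∀ l, v ≤ (Function.update J k γ l).extent := by
      intro v γ hv hγ l
      rcases eq_or_ne l k with rfl | hl
      · simpa using hγ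
      · simpa [Function.update_of_ne hl] using hv.trans (hJ l)
    split_ifs with hk
    · refine le_of_sing (J := Function.update J k β) (X := k)
        (by simpa using inf_le_right.trans inf_le_left)
        (inf_le_right.trans (inf_le_right.trans inf_le_left)) fun n v hv hβ hβ' => ?_
      simp only [Function.update_self] at hβ hβ'
      refine le_trans (le_inf le_rfl ?_) (ih (u := v) (J := Function.update J k (single n))
        (ext (hv.trans inf_le_left) (by rw [extent_single]; exact le_top)) fun l hl hl' hlk => ?_)
      · refine le_trans (le_inf le_rfl ?_) (inf_mSat_update_le hβ hβ' _)
        exact hv.trans (inf_le_right.trans (inf_le_right.trans inf_le_right))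
      · rcases eq_or_ne l k with rfl | hne
        · exact ⟨n, by simp⟩
        · rw [Function.update_of_ne hne]
          exact hs l hl hl' (by simp [hlk, hne])
    · rw [← inf_assoc]
      refine ih (ext inf_le_left inf_le_right) fun l hl hl' hlk => ?_
      have hne : l ≠ k := by rintro rfl; exact hk hl'
      rw [Function.update_of_ne hne]
      exact hs l hl hl' (by simp [hlk, hne])

/-- Satisfiability is truth of the existential closure. -/
theorem hSatisfiable_eq_closure (e₁ : V₁ ↪ ℕ) (e₂ : V₂ ↪ ℕ) {φ : Form V₁ V₂} {N : ℕ}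
    (hN : (φ.tr e₁ e₂).Below N) :
    hSatisfiable H φ =
      mSat (fun _ => const fun _ => false) (closure (List.range N) (φ.tr e₁ e₂)) := by
  apply le_antisymm
  · refine iSup_le fun I => ?_
    rw [hSatisfies_eq_mSat_toCore e₁ e₂,
      mSat_congr hN (J' := fun k => if k < N then I.toCore e₁ e₂ k else const fun _ => false)
        fun k hk => by simp [hk]]
    refine mSat_le_closure (fun k => ?_) (fun k hk hk' => ?_) (fun k hk => ?_) _
    · split_ifs
      · exact I.extent_le_toCore e₁ e₂ k
      · rw [extent_const]; exact le_top
    · rw [List.mem_range] at hk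
      exact ⟨Function.extend e₁ I.fst (fun _ => 0) (k / 2), by simp [hk, HInterp.toCore, hk']⟩
    · rw [List.mem_range] at hk
      simp [hk]
  · refine le_trans (le_inf le_top le_rfl) (closure_le_hSatisfiable e₁ e₂ hN _
      (fun _ => by rw [extent_const]) fun k hk _ hk' => absurd (List.mem_range.2 hk) hk')

end Translation

/-! ### Consequences of recognition -/

/-- By `le_of_cuts` it suffices to treat stages at which cuts with fixed colors exist, and there `P
s e` settles the formula. -/
theorem Recognises.em {N : ℕ} {Γ : Type} [AddSemigroup Γ] [Finite Γ] {h : (ℕ → Bool) → Γ}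
    {P : Γ → Γ → Prop} {φ : MForm} (hφ : Recognises H N h P φ) {u : H} (hu : u ≤ hRF H)
    {J : ℕ → HSeq H Bool} (hJ : ∀ k, u ≤ (J k).extent) : u ≤ mSat J φ ⊔ (mSat J φ)ᶜ := by
  -- All variables are interleaved into one sequence, so that a point determines a whole
  -- interpretation.
  let ρ : HSeq H Bool := fun j b => J j.unpair.1 j.unpair.2 b
  have hρ : u ≤ ρ.extent := HSeq.le_extent_iff.2
    ⟨fun j => (HSeq.le_extent_iff.1 (hJ _)).1 _, fun j => (HSeq.le_extent_iff.1 (hJ _)).2 _⟩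
  let x : ℕ → (ℕ → Bool) → ℕ → Bool := fun v z n => z (Nat.pair v n)
  have hx : ∀ v, Rep u ρ (x v) (J v) := fun v z _ n =>
    ⟨Nat.pair v n + 1, inf_le_right.trans ((pre_le (Nat.lt_succ_self _)).trans
      (by simp only [ρ, x, Nat.unpair_pair]; exact le_rfl))⟩
  have hw := cont_word (N := N) fun v => (hx v).cont (hJ v)
  have hc : Cont u ρ fun z n => h (word N x z n) := fun z hz n => by
    filter_upwards [hw z hz n] with z' hz'
    rw [hz']
  refine le_of_cuts hu hρ hc fun v hv B τ hτ k hk s e hs => ?_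
  have := hφ v (hv.trans hu) _ (zip ρ τ) (extent_zip (hv.trans hρ) hτ) J
    (fun a z => x a fun i => (z i).1) (fun a => hv.trans (hJ a))
    (fun a => ((hx a).mono hv).zip_left τ) k hk s e hs
  by_cases hP : P s e
  · exact (this.1 hP).trans le_sup_left
  · exact (le_compl_iff_disjoint_right.2 (disjoint_iff_inf_le.2 (this.2 hP))).trans le_sup_right

/-- The all-false word can be cut at every position, so both colors are that of the all-false
letter. -/
theorem Recognises.const {N : ℕ} {Γ : Type} [AddSemigroup Γ] {h : (ℕ → Bool) → Γ}
    {P : Γ → Γ → Prop} {φ : MForm} (hφ : Recognises H N h P φ) :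
    (P (h fun _ => false) (h fun _ => false) →
      hRF H ≤ mSat (fun _ => const fun _ => false) φ) ∧
    (¬ P (h fun _ => false) (h fun _ => false) →
      hRF H ⊓ mSat (fun _ => const fun _ => false) φ ≤ ⊥) := by
  refine hφ _ le_rfl Unit (S1S.const fun _ => ()) (by rw [extent_const]; exact le_top) _
    (fun _ _ _ => false) (fun _ => by rw [extent_const]; exact le_top)
    (fun _ z _ n => ⟨0, by rw [S1S.const, truth_of rfl]; exact le_top⟩) (fun _ n => n)
    (fun _ _ _ => Filter.Eventually.of_forall fun _ => rfl) _ _ fun z _ => ?_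
  have hw : ∀ n, word N (fun _ _ _ => false) z n = fun _ => false := fun n => by
    funext v; simp [word, cutoff]
  exact ⟨rfl, strictMono_id, by simp only [hw, col_single], fun i => by simp only [hw, col_single]⟩

end

/-! ### Closure properties of primitive recursive functions -/

section PrimrecRules

attribute [fun_prop] Primrec

variable {α β γ : Type*} [Primcodable α] [Primcodable β] [Primcodable γ]

theorem primrec_id : Primrec fun a : α => a := Primrec.id

attribute [fun_prop] primrec_id Primrec.const Primrec.comp Primrec.pair

@[fun_prop]
theorem primrec_fst {f : α → β × γ} (hf : Primrec f) : Primrec fun a => (f a).1 :=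
  Primrec.fst.comp hf

@[fun_prop]
theorem primrec_snd {f : α → β × γ} (hf : Primrec f) : Primrec fun a => (f a).2 :=
  Primrec.snd.comp hf

@[fun_prop]
theorem primrec_add {f g : α → ℕ} (hf : Primrec f) (hg : Primrec g) :
    Primrec fun a => f a + g a :=
  Primrec.nat_add.comp hf hg

@[fun_prop]
theorem primrec_mul {f g : α → ℕ} (hf : Primrec f) (hg : Primrec g) :
    Primrec fun a => f a * g a :=
  Primrec.nat_mul.comp hf hg

@[fun_prop]
theorem primrec_div {f g : α → ℕ} (hf : Primrec f) (hg : Primrec g) :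
    Primrec fun a => f a / g a :=
  Primrec.nat_div.comp hf hg

@[fun_prop]
theorem primrec_mod {f g : α → ℕ} (hf : Primrec f) (hg : Primrec g) :
    Primrec fun a => f a % g a :=
  Primrec.nat_mod.comp hf hg

@[fun_prop]
theorem primrec_pow {f g : α → ℕ} (hf : Primrec f) (hg : Primrec g) :
    Primrec fun a => f a ^ g a :=
  (Primrec₂.unpaired'.1 Nat.Primrec.pow).comp hf hg

@[fun_prop]
theorem primrec_unpair {f : α → ℕ} (hf : Primrec f) : Primrec fun a => (f a).unpair :=
  Primrec.unpair.comp hf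

@[fun_prop]
theorem primrec_beq {f g : α → ℕ} (hf : Primrec f) (hg : Primrec g) :
    Primrec fun a => f a == g a :=
  Primrec.beq.comp hf hg

@[fun_prop]
theorem primrec_or {f g : α → Bool} (hf : Primrec f) (hg : Primrec g) :
    Primrec fun a => f a || g a :=
  Primrec.or.comp hf hg

@[fun_prop]
theorem primrec_and {f g : α → Bool} (hf : Primrec f) (hg : Primrec g) :
    Primrec fun a => f a && g a :=
  Primrec.and.comp hf hg

@[fun_prop]
theorem primrec_not {f : α → Bool} (hf : Primrec f) : Primrec fun a => !f a :=
  Primrec.not.comp hf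

@[fun_prop]
theorem primrec_cond {c : α → Bool} {f g : α → β} (hc : Primrec c) (hf : Primrec f)
    (hg : Primrec g) : Primrec fun a => cond (c a) (f a) (g a) :=
  Primrec.cond hc hf hg

@[fun_prop]
theorem primrec_testBit {f g : α → ℕ} (hf : Primrec f) (hg : Primrec g) :
    Primrec fun a => (f a).testBit (g a) := by
  have : Primrec fun a => f a / 2 ^ g a % 2 == 1 := by fun_prop
  refine this.of_eq fun a => ?_
  rw [Nat.testBit_eq_decide_div_mod_eq]
  rfl

@[fun_prop]
theorem primrec_getD {l : α → List β} {i : α → ℕ} {d : β} (hl : Primrec l) (hi : Primrec i) :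
    Primrec fun a => (l a).getD (i a) d :=
  (Primrec.list_getD d).comp hl hi

@[fun_prop]
theorem primrec_length {l : α → List β} (hl : Primrec l) : Primrec fun a => (l a).length :=
  Primrec.list_length.comp hl

@[fun_prop]
theorem primrec_range {n : α → ℕ} (hn : Primrec n) : Primrec fun a => List.range (n a) :=
  Primrec.list_range.comp hn

@[fun_prop]
theorem primrec_concat {l : α → List β} {b : α → β} (hl : Primrec l) (hb : Primrec b) :
    Primrec fun a => l a ++ [b a] :=
  Primrec.list_concat.comp hl hb

@[fun_prop]
theorem primrec_map {l : α → List β} {f : α → β → γ} (hl : Primrec l)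
    (hf : Primrec fun p : α × β => f p.1 p.2) : Primrec fun a => (l a).map (f a) :=
  Primrec.list_map hl hf

@[fun_prop]
theorem primrec_foldr {l : α → List β} {b : α → γ} {f : α → β → γ → γ} (hl : Primrec l)
    (hb : Primrec b) (hf : Primrec fun p : α × β × γ => f p.1 p.2.1 p.2.2) :
    Primrec fun a => (l a).foldr (f a) (b a) :=
  Primrec.list_foldr (h := fun a p => f a p.1 p.2) hl hb hf

theorem primrec_natRec {n : α → ℕ} {b : α → β} {f : α → ℕ → β → β} (hn : Primrec n)
    (hb : Primrec b) (hf : Primrec fun p : α × ℕ × β => f p.1 p.2.1 p.2.2) :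
    Primrec fun a => (Nat.rec (b a) (f a) (n a) : β) :=
  Primrec.nat_rec' (h := fun a p => f a p.1 p.2) hn hb hf

end PrimrecRules

section Bounded

/-- Some number below `n` satisfies `p`. -/
def anyBelow (n : ℕ) (p : ℕ → Bool) : Bool := Nat.rec false (fun i b => b || p i) n

theorem anyBelow_eq_true {n : ℕ} {p : ℕ → Bool} :
    anyBelow n p = true ↔ ∃ i < n, p i = true := by
  induction n with
  | zero => simp [anyBelow]
  | succ n ih =>
    have : anyBelow (n + 1) p = (anyBelow n p || p n) := rfl
    rw [this, Bool.or_eq_true, ih]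
    constructor
    · rintro (⟨i, hi, h⟩ | h)
      · exact ⟨i, by omega, h⟩
      · exact ⟨n, by omega, h⟩
    · rintro ⟨i, hi, h⟩
      rcases Nat.lt_succ_iff_lt_or_eq.1 hi with hi | rfl
      · exact Or.inl ⟨i, hi, h⟩
      · exact Or.inr h

/-- The number whose binary digits below `n` are given by `p`. -/
def mask (n : ℕ) (p : ℕ → Bool) : ℕ := Nat.rec 0 (fun i m => m + cond (p i) (2 ^ i) 0) n

theorem mask_succ (n : ℕ) (p : ℕ → Bool) :
    mask (n + 1) p = mask n p + cond (p n) (2 ^ n) 0 := rfl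

theorem mask_lt (n : ℕ) (p : ℕ → Bool) : mask n p < 2 ^ n := by
  induction n with
  | zero => simp [mask]
  | succ n ih =>
    rw [mask_succ, pow_succ]
    cases p n <;> simp only [cond_true, cond_false] <;> omega

theorem testBit_mask (n : ℕ) (p : ℕ → Bool) (i : ℕ) :
    (mask n p).testBit i = (decide (i < n) && p i) := by
  induction n with
  | zero => simp [mask]
  | succ n ih =>
    rw [mask_succ]
    cases hp : p n
    · rw [cond_false, add_zero, ih]
      rcases lt_trichotomy i n with h | rfl | h
      · simp [h, Nat.lt_succ_of_lt h]
      · simp [hp]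
      · simp [h.not_gt, h.not_ge]
    · rw [cond_true, add_comm]
      rcases lt_trichotomy i n with h | rfl | h
      · rw [Nat.testBit_two_pow_add_gt h, ih]
        simp [h, Nat.lt_succ_of_lt h]
      · rw [Nat.testBit_two_pow_add_eq, ih]
        simp [hp]
      · rw [Nat.testBit_lt_two_pow]
        · simp [h.not_ge]
        · calc 2 ^ n + mask n p < 2 ^ n + 2 ^ n := by have := mask_lt n p; omega
            _ = 2 ^ (n + 1) := by ring
            _ ≤ 2 ^ i := Nat.pow_le_pow_right (by norm_num) h

/-- The bits of `a` below `N`, with bit `X` replaced by `b`. -/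
def setBit (N a X : ℕ) (b : Bool) : ℕ := mask N fun i => cond (i == X) b (a.testBit i)

theorem testBit_setBit {N a : ℕ} (ha : a < 2 ^ N) {X : ℕ} (hX : X < N) (b : Bool) :
    (setBit N a X b).testBit = Function.update a.testBit X b := by
  funext i
  rw [setBit, testBit_mask]
  rcases eq_or_ne i X with rfl | hi
  · simp [hX]
  · rw [Function.update_of_ne hi, beq_false_of_ne hi, cond_false]
    by_cases hN : i < N
    · simp [hN]
    · rw [Nat.testBit_lt_two_pow (ha.trans_le (Nat.pow_le_pow_right (by norm_num) (by omega)))]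
      simp

variable {α : Type*} [Primcodable α]

@[fun_prop]
theorem primrec_anyBelow {n : α → ℕ} {p : α → ℕ → Bool} (hn : Primrec n)
    (hp : Primrec fun q : α × ℕ => p q.1 q.2) : Primrec fun a => anyBelow (n a) (p a) :=
  primrec_natRec (f := fun a i b => b || p a i) hn (Primrec.const _)
    (Primrec.or.comp (by fun_prop) (hp.comp (g := fun q : α × ℕ × Bool => (q.1, q.2.1))
      (by fun_prop)))

@[fun_prop]
theorem primrec_mask {n : α → ℕ} {p : α → ℕ → Bool} (hn : Primrec n)
    (hp : Primrec fun q : α × ℕ => p q.1 q.2) : Primrec fun a => mask (n a) (p a) :=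
  primrec_natRec (f := fun a i m => m + cond (p a i) (2 ^ i) 0) hn (Primrec.const _)
    (primrec_add (by fun_prop) (primrec_cond
      (hp.comp (g := fun q : α × ℕ × ℕ => (q.1, q.2.1)) (by fun_prop)) (by fun_prop)
      (by fun_prop)))

@[fun_prop]
theorem primrec_setBit {N a X : α → ℕ} {b : α → Bool} (hN : Primrec N) (ha : Primrec a)
    (hX : Primrec X) (hb : Primrec b) : Primrec fun c => setBit (N c) (a c) (X c) (b c) := by
  unfold setBit
  fun_prop

end Bounded

/-! ### Tables of recognising semigroups -/

/-- The size, the addition table, the colors of letters and the acceptance table of a finite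
semigroup whose elements are numbers. -/
abbrev Tab : Type := ℕ × List ℕ × List ℕ × List Bool

namespace Tab

def add (T : Tab) (i j : ℕ) : ℕ := T.2.1.getD (i * T.1 + j) 0

def letter (T : Tab) (a : ℕ) : ℕ := T.2.2.1.getD a 0

def acc (T : Tab) (i j : ℕ) : Bool := T.2.2.2.getD (i * T.1 + j) false

/-- Tabulation of functions for `n` elements and letters with `N` bits. -/
def tabulate (N n : ℕ) (f : ℕ → ℕ → ℕ) (g : ℕ → ℕ) (p : ℕ → ℕ → Bool) : Tab :=
  (n, (List.range (n * n)).map fun t => f (t / n) (t % n), (List.range (2 ^ N)).map g,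
    (List.range (n * n)).map fun t => p (t / n) (t % n))

theorem getD_map_range {β : Type*} {f : ℕ → β} {d : β} {n i : ℕ} (h : i < n) :
    ((List.range n).map f).getD i d = f i := by
  rw [List.getD_eq_getElem _ _ (by simpa using h)]
  simp

section

variable {N n : ℕ} {f : ℕ → ℕ → ℕ} {g : ℕ → ℕ} {p : ℕ → ℕ → Bool}

theorem index_lt {i j : ℕ} (hi : i < n) (hj : j < n) : i * n + j < n * n := by
  have : (i + 1) * n ≤ n * n := Nat.mul_le_mul_right n hi
  rw [Nat.add_mul, one_mul] at this
  omega

theorem index_div {i j : ℕ} (hj : j < n) : (i * n + j) / n = i := by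
  rw [add_comm, Nat.add_mul_div_right _ _ (by omega), Nat.div_eq_of_lt hj, zero_add]

theorem index_mod {i j : ℕ} (hj : j < n) : (i * n + j) % n = j := by
  rw [add_comm, Nat.add_mul_mod_self_right, Nat.mod_eq_of_lt hj]

theorem add_tabulate {i j : ℕ} (hi : i < n) (hj : j < n) :
    add (tabulate N n f g p) i j = f i j := by
  simp only [add, tabulate]
  rw [getD_map_range (index_lt hi hj), index_div hj, index_mod hj]

theorem acc_tabulate {i j : ℕ} (hi : i < n) (hj : j < n) :
    acc (tabulate N n f g p) i j = p i j := by
  simp only [acc, tabulate]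
  rw [getD_map_range (index_lt hi hj), index_div hj, index_mod hj]

theorem letter_tabulate {a : ℕ} (ha : a < 2 ^ N) : letter (tabulate N n f g p) a = g a :=
  getD_map_range ha

end

/-- The numbering `code` of a finite semigroup turns `h` and `P` into the table `T`. -/
structure Represents (N : ℕ) (T : Tab) {Γ : Type} [AddSemigroup Γ] (h : (ℕ → Bool) → Γ)
    (P : Γ → Γ → Prop) (code : Γ → ℕ) : Prop where
  injective : Function.Injective code
  lt : ∀ a, code a < T.1
  surj : ∀ i < T.1, ∃ a, code a = i
  add : ∀ a b, T.add (code a) (code b) = code (a + b)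
  letter : ∀ a < 2 ^ N, T.letter a = code (h a.testBit)
  acc : ∀ a b, T.acc (code a) (code b) = true ↔ P a b

/-- Tabulated functions represent `h` and `P` if they do so on codes. -/
theorem represents_tabulate {N n : ℕ} {f : ℕ → ℕ → ℕ} {g : ℕ → ℕ} {p : ℕ → ℕ → Bool}
    {Γ : Type} [AddSemigroup Γ] {h : (ℕ → Bool) → Γ} {P : Γ → Γ → Prop} {code : Γ → ℕ}
    (injective : Function.Injective code) (lt : ∀ a, code a < n)
    (surj : ∀ i < n, ∃ a, code a = i) (add : ∀ a b, f (code a) (code b) = code (a + b))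
    (letter : ∀ a < 2 ^ N, g a = code (h a.testBit))
    (acc : ∀ a b, p (code a) (code b) = true ↔ P a b) :
    Represents N (tabulate N n f g p) h P code where
  injective := injective
  lt := lt
  surj := surj
  add a b := by rw [add_tabulate (lt a) (lt b), add]
  letter a ha := by rw [letter_tabulate ha, letter a ha]
  acc a b := by rw [acc_tabulate (lt a) (lt b), acc]

/-- The table for the negation of a formula. -/
def neg (N : ℕ) (T : Tab) : Tab := tabulate N T.1 T.add T.letter fun i j => !T.acc i j

theorem Represents.neg {N : ℕ} {T : Tab} {Γ : Type} [AddSemigroup Γ] {h : (ℕ → Bool) → Γ}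
    {P : Γ → Γ → Prop} {code : Γ → ℕ} (hT : Represents N T h P code) :
    Represents N (neg N T) h (fun s e => ¬ P s e) code :=
  represents_tabulate hT.injective hT.lt hT.surj hT.add hT.letter fun a b => by
    rw [← hT.acc]; simp

/-- The table for the conjunction of two formulas. -/
def and (N : ℕ) (T T' : Tab) : Tab :=
  tabulate N (T.1 * T'.1)
    (fun i j => T.add (i / T'.1) (j / T'.1) * T'.1 + T'.add (i % T'.1) (j % T'.1))
    (fun a => T.letter a * T'.1 + T'.letter a)
    (fun i j => T.acc (i / T'.1) (j / T'.1) && T'.acc (i % T'.1) (j % T'.1))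

theorem Represents.and {N : ℕ} {T T' : Tab} {Γ Δ : Type} [AddSemigroup Γ] [AddSemigroup Δ]
    {h : (ℕ → Bool) → Γ} {h' : (ℕ → Bool) → Δ} {P : Γ → Γ → Prop} {P' : Δ → Δ → Prop}
    {code : Γ → ℕ} {code' : Δ → ℕ} (hT : Represents N T h P code)
    (hT' : Represents N T' h' P' code') :
    Represents N (and N T T') (fun a => (h a, h' a)) (fun s e => P s.1 e.1 ∧ P' s.2 e.2)
      (fun a => code a.1 * T'.1 + code' a.2) := by
  have hd : ∀ a : Γ × Δ, (code a.1 * T'.1 + code' a.2) / T'.1 = code a.1 :=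
    fun a => index_div (hT'.lt _)
  have hm : ∀ a : Γ × Δ, (code a.1 * T'.1 + code' a.2) % T'.1 = code' a.2 :=
    fun a => index_mod (hT'.lt _)
  refine represents_tabulate (fun a b hab => ?_) (fun a => ?_) (fun i hi => ?_) (fun a b => ?_)
    (fun a ha => ?_) fun a b => ?_
  · have h₁ := congrArg (· / T'.1) hab
    have h₂ := congrArg (· % T'.1) hab
    simp only [hd, hm] at h₁ h₂
    exact Prod.ext (hT.injective h₁) (hT'.injective h₂)
  · have h₁ : (code a.1 + 1) * T'.1 ≤ T.1 * T'.1 := Nat.mul_le_mul_right _ (hT.lt _)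
    have h₂ := hT'.lt a.2
    rw [Nat.add_mul, one_mul] at h₁
    omega
  · have hpos : 0 < T'.1 := Nat.pos_of_ne_zero fun h0 => by simp [h0] at hi
    obtain ⟨a, ha⟩ := hT.surj (i / T'.1) (Nat.div_lt_of_lt_mul (by rwa [mul_comm]))
    obtain ⟨b, hb⟩ := hT'.surj (i % T'.1) (Nat.mod_lt _ hpos)
    exact ⟨(a, b), by rw [ha, hb, Nat.div_add_mod']⟩
  · simp only [hd, hm, hT.add, hT'.add, Prod.fst_add, Prod.snd_add]
  · rw [hT.letter a ha, hT'.letter a ha]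
  · simp only [hd, hm, Bool.and_eq_true, hT.acc, hT'.acc]

/-- The sum of the subsets with bit masks `S` and `S'`. -/
def setAdd (T : Tab) (S S' : ℕ) : ℕ :=
  mask T.1 fun c => anyBelow T.1 fun a => anyBelow T.1 fun b =>
    S.testBit a && (S'.testBit b && T.add a b == c)

/-- The `(j + 1)`-fold sum of the subset with bit mask `E`. -/
def setPw (T : Tab) (E j : ℕ) : ℕ := Nat.rec E (fun _ p => T.setAdd p E) j

/-- The table for the projection of a formula. -/
def ex (N : ℕ) (T : Tab) (X : ℕ) : Tab :=
  tabulate N (2 ^ T.1) T.setAdd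
    (fun a => mask T.1 fun c =>
      c == T.letter (setBit N a X false) || c == T.letter (setBit N a X true))
    (fun S E => anyBelow (2 ^ T.1) fun j => anyBelow (2 ^ T.1) fun m =>
      anyBelow T.1 fun s => anyBelow T.1 fun e =>
        (T.setAdd S (T.setPw E j)).testBit s && ((T.setPw E m).testBit e && T.acc s e))

/-- Among the first `M + 1` multiples two agree, and the agreement persists when more summands are
added, so a large index can be lowered. This bounds the searches in `Tab.ex`. -/
theorem exists_pw_eq_of_lt {Γ : Type} [AddSemigroup Γ] {code : Γ → ℕ}
    (hc : Function.Injective code) {M : ℕ} (hM : ∀ a, code a < M) (e : Γ) (j : ℕ) :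
    ∃ i < M, pw e i = pw e j := by
  induction j using Nat.strong_induction_on with
  | _ j ih =>
  rcases lt_or_ge j M with hj | hj
  · exact ⟨j, hj, rfl⟩
  obtain ⟨a, ha, b, hb, hab, heq⟩ := Finset.exists_ne_map_eq_of_card_lt_of_maps_to
    (s := Finset.range (M + 1)) (t := Finset.range M) (f := fun i => code (pw e i)) (by simp)
    (fun i _ => by simpa using hM _)
  rw [Finset.mem_range] at ha hb
  wlog hlt : a < b generalizing a b
  · exact this b hb a ha hab.symm heq.symm (by omega)
  have shift : ∀ t, pw e (a + t) = pw e (b + t) := by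
    intro t
    induction t with
    | zero => exact hc heq
    | succ t iht => rw [← add_assoc, ← add_assoc, pw, pw, iht]
  obtain ⟨i, hi, h⟩ := ih (a + (j - b)) (by omega)
  exact ⟨i, hi, by rw [h, shift, Nat.add_sub_cancel' (by omega)]⟩

open scoped Pointwise

/-- Subsets are numbered by bit masks. Since `code` is onto the numbers below `T.1`, bounded
searches become quantifiers over `Γ`. -/
theorem Represents.ex {N : ℕ} {T : Tab} {Γ : Type} [AddSemigroup Γ] {h : (ℕ → Bool) → Γ}
    {P : Γ → Γ → Prop} {code : Γ → ℕ} (hT : Represents N T h P code) {X : ℕ} (hX : X < N) :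
    ∃ code' : Set Γ → ℕ, Represents N (ex N T X) (projColor h X) (projAcc P) code' := by
  classical
  let code' : Set Γ → ℕ := fun S => mask T.1 fun c => decide (∃ a ∈ S, code a = c)
  have bit : ∀ S a, (code' S).testBit (code a) = true ↔ a ∈ S := by
    intro S a
    simp only [code', testBit_mask, hT.lt a, decide_true, Bool.true_and, decide_eq_true_eq]
    exact ⟨fun ⟨b, hb, hab⟩ => hT.injective hab ▸ hb, fun ha => ⟨a, ha, rfl⟩⟩
  have inj : Function.Injective code' := fun S S' hS => by
    ext a
    rw [← bit S, hS, bit]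
  have hlt : ∀ S, code' S < 2 ^ T.1 := fun S => mask_lt _ _
  have any : ∀ p : ℕ → Bool, anyBelow T.1 p = true ↔ ∃ a, p (code a) = true := by
    intro p
    rw [anyBelow_eq_true]
    constructor
    · rintro ⟨i, hi, h⟩
      obtain ⟨a, rfl⟩ := hT.surj i hi
      exact ⟨a, h⟩
    · rintro ⟨a, h⟩
      exact ⟨_, hT.lt a, h⟩
  have hadd : ∀ S S', T.setAdd (code' S) (code' S') = code' (S + S') := by
    intro S S'
    simp only [setAdd, code']
    congr 1
    funext c
    rw [Bool.eq_iff_iff, decide_eq_true_eq, any]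
    simp only [any, Bool.and_eq_true, beq_iff_eq, hT.add, Set.mem_add]
    constructor
    · rintro ⟨a, b, ha, hb, rfl⟩
      exact ⟨_, ⟨a, (bit S a).1 ha, b, (bit S' b).1 hb, rfl⟩, rfl⟩
    · rintro ⟨_, ⟨a, ha, b, hb, rfl⟩, rfl⟩
      exact ⟨a, b, (bit S a).2 ha, (bit S' b).2 hb, rfl⟩
  have hpw : ∀ E j, T.setPw (code' E) j = code' (pw E j) := by
    intro E j
    induction j with
    | zero => rfl
    | succ j ih =>
      have : T.setPw (code' E) (j + 1) = T.setAdd (T.setPw (code' E) j) (code' E) := rfl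
      rw [this, ih, hadd, pw]
  refine ⟨code', represents_tabulate inj hlt (fun i hi => ?_) hadd (fun a ha => ?_)
    fun S E => ?_⟩
  · refine ⟨{a | i.testBit (code a) = true}, Nat.eq_of_testBit_eq fun c => ?_⟩
    by_cases hc : c < T.1
    · obtain ⟨a, rfl⟩ := hT.surj c hc
      rw [Bool.eq_iff_iff, bit]
      rfl
    · simp only [code', testBit_mask, hc, decide_false, Bool.false_and]
      rw [Nat.testBit_lt_two_pow (hi.trans_le (Nat.pow_le_pow_right (by norm_num) (by omega)))]
  · simp only [code']
    congr 1
    funext c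
    have hb : ∀ b, T.letter (setBit N a X b) = code (h (Function.update a.testBit X b)) :=
      fun b => by rw [hT.letter (setBit N a X b) (mask_lt _ _), testBit_setBit ha hX]
    rw [Bool.eq_iff_iff, decide_eq_true_eq, hb, hb]
    simp only [projColor, Set.exists_range_iff, Bool.or_eq_true, beq_iff_eq, Bool.exists_bool]
    simp only [eq_comm]
  · simp only [anyBelow_eq_true (n := 2 ^ T.1), any, Bool.and_eq_true, hadd, hpw, bit, hT.acc,
      projAcc]
    constructor
    · rintro ⟨j, _, m, _, s, e, hs, he, hP⟩
      exact ⟨j, m, s, e, hs, he, hP⟩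
    · rintro ⟨j, m, s, e, hs, he, hP⟩
      obtain ⟨j', hj', hj⟩ := exists_pw_eq_of_lt inj hlt E j
      obtain ⟨m', hm', hm⟩ := exists_pw_eq_of_lt inj hlt E m
      exact ⟨j', hj', m', hm', s, e, hj ▸ hs, hm ▸ he, hP⟩

/-- The atomic color with a given number. -/
def ofCode (i : ℕ) : AtomColor := ⟨i.testBit 2, i.testBit 1, i.testBit 0⟩

/-- The number of an atomic color. -/
def atomCode (x y l : Bool) : ℕ := cond x 4 0 + cond y 2 0 + cond l 1 0

theorem ofCode_atomCode (c : AtomColor) : ofCode (atomCode c.fst c.snd c.hit) = c := by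
  obtain ⟨a, b, c⟩ := c
  cases a <;> cases b <;> cases c <;> rfl

/-- The table for an atomic formula whose letters have the numbers `g`. -/
def atom (N : ℕ) (g : ℕ → ℕ) : Tab :=
  tabulate N 8
    (fun i j => atomCode (ofCode i + ofCode j).fst (ofCode i + ofCode j).snd
      (ofCode i + ofCode j).hit) g
    fun i j => (ofCode i + (ofCode j + ofCode j)).hit

theorem represents_atom {N : ℕ} {g : ℕ → ℕ} {h : (ℕ → Bool) → AtomColor}
    (hg : ∀ a < 2 ^ N, g a = atomCode (h a.testBit).fst (h a.testBit).snd (h a.testBit).hit) :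
    Represents N (atom N g) h (fun s e => (s + (e + e)).hit = true)
      fun c => atomCode c.fst c.snd c.hit := by
  refine represents_tabulate (Function.LeftInverse.injective ofCode_atomCode) (fun c => ?_)
    (fun i hi => ⟨ofCode i, ?_⟩) (fun a b => ?_) hg fun a b => ?_
  · obtain ⟨a, b, c⟩ := c
    cases a <;> cases b <;> cases c <;> decide
  · interval_cases i <;> rfl
  · simp only [ofCode_atomCode]
  · simp only [ofCode_atomCode]

/-- The table for `lt X Y`. -/
def lt (N X Y : ℕ) : Tab := atom N fun a => atomCode (a.testBit X) (a.testBit Y) false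

/-- The table for `meet X Y`. -/
def meet (N X Y : ℕ) : Tab :=
  atom N fun a => atomCode false false (a.testBit X && a.testBit Y)

end Tab

/-- The table of a core formula with variables below `N`. -/
def MForm.tab (N : ℕ) : MForm → Tab
  | .lt X Y => Tab.lt N X Y
  | .meet X Y => Tab.meet N X Y
  | .and φ ψ => Tab.and N (φ.tab N) (ψ.tab N)
  | .neg φ => Tab.neg N (φ.tab N)
  | .ex X φ => Tab.ex N (φ.tab N) X

/-- The semigroup may be chosen separately for each `H`, but its table is `φ.tab N`; hence one
decision function serves all frames. -/
theorem exists_recognises (H : Type u) [Order.Frame H] {N : ℕ} {φ : MForm} (hφ : φ.Below N) :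
    ∃ (Γ : Type) (_ : AddSemigroup Γ) (_ : Finite Γ) (h : (ℕ → Bool) → Γ) (P : Γ → Γ → Prop)
      (code : Γ → ℕ), Tab.Represents N (φ.tab N) h P code ∧ Recognises H N h P φ := by
  induction φ with
  | lt X Y =>
    exact ⟨_, _, inferInstance, _, _, _, Tab.represents_atom fun _ _ => rfl,
      recognises_lt hφ.1 hφ.2⟩
  | meet X Y =>
    exact ⟨_, _, inferInstance, _, _, _, Tab.represents_atom fun _ _ => rfl,
      recognises_meet hφ.1 hφ.2⟩
  | and φ ψ ihφ ihψ =>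
    obtain ⟨Γ, _, _, h, P, code, hT, hR⟩ := ihφ hφ.1
    obtain ⟨Δ, _, _, h', P', code', hT', hR'⟩ := ihψ hφ.2
    exact ⟨_, _, inferInstance, _, _, _, hT.and hT', hR.and hR'⟩
  | neg φ ih =>
    obtain ⟨Γ, _, _, h, P, code, hT, hR⟩ := ih hφ
    exact ⟨_, _, inferInstance, _, _, _, hT.neg, hR.neg⟩
  | ex X φ ih =>
    obtain ⟨Γ, _, _, h, P, code, hT, hR⟩ := ih hφ.2
    obtain ⟨code', hT'⟩ := hT.ex hφ.1
    exact ⟨_, _, inferInstance, _, _, _, hT', hR.ex hφ.1⟩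

/-! ### The decision function -/

/-- The table for the formula with code `c`, given the list of tables for the numbers below
`c`. -/
def nextTab (N : ℕ) (l : List Tab) : Tab :=
  let p := (l.length / 6).unpair
  let T := fun i => l.getD i (0, [], [], [])
  cond (l.length % 6 == 0) (Tab.lt N (2 * p.1) (2 * p.2)) <|
  cond (l.length % 6 == 1) (Tab.meet N (2 * p.1) (2 * p.2 + 1)) <|
  cond (l.length % 6 == 2) (Tab.and N (T p.1) (T p.2)) <|
  cond (l.length % 6 == 3) (Tab.neg N (T (l.length / 6))) <|
  cond (l.length % 6 == 4)
    (Tab.ex N (Tab.and N (Tab.and N (Tab.meet N (2 * p.1) (2 * p.1))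
      (Tab.neg N (Tab.lt N (2 * p.1) (2 * p.1)))) (T p.2)) (2 * p.1)) <|
  Tab.ex N (T p.2) (2 * p.1 + 1)

/-- The tables for the numbers below `c`. -/
def tabs (N c : ℕ) : List Tab := Nat.rec [] (fun _ l => l ++ [nextTab N l]) c

theorem tabs_succ (N c : ℕ) : tabs N (c + 1) = tabs N c ++ [nextTab N (tabs N c)] := rfl

theorem length_tabs (N c : ℕ) : (tabs N c).length = c := by
  induction c with
  | zero => rfl
  | succ c ih => rw [tabs_succ, List.length_append, ih, List.length_singleton]

theorem getD_tabs (N : ℕ) {i c : ℕ} (h : i < c) (d : Tab) :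
    (tabs N c).getD i d = nextTab N (tabs N i) := by
  induction c, h using Nat.le_induction with
  | base =>
    rw [tabs_succ, List.getD_append_right _ _ _ _ (by simp [length_tabs])]
    simp [length_tabs]
  | succ c hc ih =>
    rw [tabs_succ, List.getD_append _ _ _ _ (by rw [length_tabs]; exact hc), ih]

/-- Course-of-values recursion: the length of the list is the code in question, and immediate
subformulas have smaller codes, so their tables are already listed. -/
theorem nextTab_code {V₁ : Type v} {V₂ : Type w} (e₁ : V₁ ↪ ℕ) (e₂ : V₂ ↪ ℕ) (N : ℕ)
    (φ : Form V₁ V₂) : nextTab N (tabs N (φ.code e₁ e₂)) = (φ.tr e₁ e₂).tab N := by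
  induction φ with
  | lt x y =>
    simp [nextTab, length_tabs, Form.code, Form.tr, MForm.tab]
  | mem x X =>
    have h : ∀ q : ℕ, (6 * q + 1) / 6 = q ∧ (6 * q + 1) % 6 = 1 := fun q => by omega
    simp [nextTab, length_tabs, Form.code, Form.tr, MForm.tab, h]
  | and φ ψ ihφ ihψ =>
    have h : ∀ q : ℕ, (6 * q + 2) / 6 = q ∧ (6 * q + 2) % 6 = 2 := fun q => by omega
    have h₁ := Nat.left_le_pair (φ.code e₁ e₂) (ψ.code e₁ e₂)
    have h₂ := Nat.right_le_pair (φ.code e₁ e₂) (ψ.code e₁ e₂)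
    simp only [nextTab, length_tabs, Form.code, Form.tr, MForm.tab, h, Nat.unpair_pair]
    rw [getD_tabs N (by omega), getD_tabs N (by omega), ihφ, ihψ]
    rfl
  | neg φ ih =>
    have h : ∀ q : ℕ, (6 * q + 3) / 6 = q ∧ (6 * q + 3) % 6 = 3 := fun q => by omega
    simp only [nextTab, length_tabs, Form.code, Form.tr, MForm.tab, h]
    rw [getD_tabs N (by omega : φ.code e₁ e₂ < _), ih]
    rfl
  | exFst x φ ih =>
    have h : ∀ q : ℕ, (6 * q + 4) / 6 = q ∧ (6 * q + 4) % 6 = 4 := fun q => by omega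
    have h₂ := Nat.right_le_pair (e₁ x) (φ.code e₁ e₂)
    simp only [nextTab, length_tabs, Form.code, Form.tr, sing, MForm.tab, h, Nat.unpair_pair]
    rw [getD_tabs N (by omega : φ.code e₁ e₂ < _), ih]
    rfl
  | exSnd X φ ih =>
    have h : ∀ q : ℕ, (6 * q + 5) / 6 = q ∧ (6 * q + 5) % 6 = 5 := fun q => by omega
    have h₂ := Nat.right_le_pair (e₂ X) (φ.code e₁ e₂)
    simp only [nextTab, length_tabs, Form.code, Form.tr, MForm.tab, h, Nat.unpair_pair]
    rw [getD_tabs N (by omega : φ.code e₁ e₂ < _), ih]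
    rfl

/-- The table of the existential closure of the formula with table `T`. -/
def closureTab (N : ℕ) (T : Tab) : Tab :=
  (List.range N).foldr (fun k T => Tab.ex N (cond (k % 2 == 0)
    (Tab.and N (Tab.and N (Tab.meet N k k) (Tab.neg N (Tab.lt N k k))) T) T) k) T

theorem tab_closure (N : ℕ) (φ : MForm) :
    (closure (List.range N) φ).tab N = closureTab N (φ.tab N) := by
  unfold closure closureTab
  induction List.range N with
  | nil => rfl
  | cons k ks ih =>
    rw [List.foldr_cons, List.foldr_cons, MForm.tab, ← ih]
    by_cases hk : k % 2 = 0
    · rw [if_pos hk, hk]; rfl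
    · rw [if_neg hk, beq_false_of_ne hk]; rfl

/-- The decision function for satisfiability. -/
def decideSat (c : ℕ) : Bool :=
  let T := closureTab (2 * c + 2) (nextTab (2 * c + 2) (tabs (2 * c + 2) c))
  T.acc (T.letter 0) (T.letter 0)

section PrimrecTab

variable {α : Type*} [Primcodable α]

@[fun_prop]
theorem primrec_tab_add {T : α → Tab} {i j : α → ℕ} (hT : Primrec T) (hi : Primrec i)
    (hj : Primrec j) : Primrec fun a => (T a).add (i a) (j a) := by
  unfold Tab.add
  fun_prop

@[fun_prop]
theorem primrec_tab_letter {T : α → Tab} {i : α → ℕ} (hT : Primrec T) (hi : Primrec i) :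
    Primrec fun a => (T a).letter (i a) := by
  unfold Tab.letter
  fun_prop

@[fun_prop]
theorem primrec_tab_acc {T : α → Tab} {i j : α → ℕ} (hT : Primrec T) (hi : Primrec i)
    (hj : Primrec j) : Primrec fun a => (T a).acc (i a) (j a) := by
  unfold Tab.acc
  fun_prop

theorem primrec_tabulate {N n : α → ℕ} {f : α → ℕ → ℕ → ℕ} {g : α → ℕ → ℕ}
    {p : α → ℕ → ℕ → Bool} (hN : Primrec N) (hn : Primrec n)
    (hf : Primrec fun q : α × ℕ × ℕ => f q.1 q.2.1 q.2.2)
    (hg : Primrec fun q : α × ℕ => g q.1 q.2)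
    (hp : Primrec fun q : α × ℕ × ℕ => p q.1 q.2.1 q.2.2) :
    Primrec fun a => Tab.tabulate (N a) (n a) (f a) (g a) (p a) := by
  have hq : Primrec fun q : α × ℕ => (q.1, q.2 / n q.1, q.2 % n q.1) := by fun_prop
  exact Primrec.pair hn (Primrec.pair (primrec_map (by fun_prop) (hf.comp hq))
    (Primrec.pair (primrec_map (by fun_prop) hg) (primrec_map (by fun_prop) (hp.comp hq))))

@[fun_prop]
theorem primrec_tab_neg {N : α → ℕ} {T : α → Tab} (hN : Primrec N) (hT : Primrec T) :
    Primrec fun a => Tab.neg (N a) (T a) :=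
  primrec_tabulate (by fun_prop) (by fun_prop) (by fun_prop) (by fun_prop) (by fun_prop)

@[fun_prop]
theorem primrec_tab_and {N : α → ℕ} {T T' : α → Tab} (hN : Primrec N) (hT : Primrec T)
    (hT' : Primrec T') : Primrec fun a => Tab.and (N a) (T a) (T' a) :=
  primrec_tabulate (by fun_prop) (by fun_prop) (by fun_prop) (by fun_prop) (by fun_prop)

@[fun_prop]
theorem primrec_tab_setAdd {T : α → Tab} {i j : α → ℕ} (hT : Primrec T) (hi : Primrec i)
    (hj : Primrec j) : Primrec fun a => (T a).setAdd (i a) (j a) := by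
  unfold Tab.setAdd
  fun_prop

@[fun_prop]
theorem primrec_tab_setPw {T : α → Tab} {i j : α → ℕ} (hT : Primrec T) (hi : Primrec i)
    (hj : Primrec j) : Primrec fun a => (T a).setPw (i a) (j a) :=
  primrec_natRec (f := fun a _ p => (T a).setAdd p (i a)) hj hi (by fun_prop)

@[fun_prop]
theorem primrec_tab_ex {N : α → ℕ} {T : α → Tab} {X : α → ℕ} (hN : Primrec N)
    (hT : Primrec T) (hX : Primrec X) : Primrec fun a => Tab.ex (N a) (T a) (X a) :=
  primrec_tabulate (by fun_prop) (by fun_prop) (by fun_prop) (by fun_prop) (by fun_prop)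

@[fun_prop]
theorem primrec_atomCode {x y l : α → Bool} (hx : Primrec x) (hy : Primrec y)
    (hl : Primrec l) : Primrec fun a => Tab.atomCode (x a) (y a) (l a) := by
  unfold Tab.atomCode
  fun_prop

/-- The addition and acceptance tables of atoms are fixed lists; only the letters vary. -/
theorem primrec_tab_atom {N : α → ℕ} {g : α → ℕ → ℕ} (hN : Primrec N)
    (hg : Primrec fun q : α × ℕ => g q.1 q.2) : Primrec fun a => Tab.atom (N a) (g a) :=
  Primrec.pair (by fun_prop) (Primrec.pair (Primrec.const _)
    (Primrec.pair (primrec_map (by fun_prop) hg) (Primrec.const _)))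

@[fun_prop]
theorem primrec_tab_lt {N X Y : α → ℕ} (hN : Primrec N) (hX : Primrec X) (hY : Primrec Y) :
    Primrec fun a => Tab.lt (N a) (X a) (Y a) :=
  primrec_tab_atom hN (by fun_prop)

@[fun_prop]
theorem primrec_tab_meet {N X Y : α → ℕ} (hN : Primrec N) (hX : Primrec X)
    (hY : Primrec Y) : Primrec fun a => Tab.meet (N a) (X a) (Y a) :=
  primrec_tab_atom hN (by fun_prop)

@[fun_prop]
theorem primrec_nextTab {N : α → ℕ} {l : α → List Tab} (hN : Primrec N) (hl : Primrec l) :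
    Primrec fun a => nextTab (N a) (l a) := by
  simp only [nextTab]
  fun_prop

@[fun_prop]
theorem primrec_tabs {N c : α → ℕ} (hN : Primrec N) (hc : Primrec c) :
    Primrec fun a => tabs (N a) (c a) :=
  primrec_natRec (f := fun a _ l => l ++ [nextTab (N a) l]) hc (Primrec.const _) (by fun_prop)

@[fun_prop]
theorem primrec_closureTab {N : α → ℕ} {T : α → Tab} (hN : Primrec N) (hT : Primrec T) :
    Primrec fun a => closureTab (N a) (T a) := by
  unfold closureTab
  fun_prop

theorem primrec_decideSat : Primrec decideSat := by
  unfold decideSat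
  fun_prop

end PrimrecTab

/-! ### The constructive reading -/

theorem hRF_le_em (H : Type u) [Order.Frame H] {V₁ : Type v} {V₂ : Type w} [Finite V₁]
    [Finite V₂] [DecidableEq V₁] [DecidableEq V₂] (I : HInterp H V₁ V₂) (φ : Form V₁ V₂) :
    hRF H ≤ I.extent ⇨ (hSatisfies I φ ⊔ (hSatisfies I φ)ᶜ) := by
  obtain ⟨e₁⟩ : Nonempty (V₁ ↪ ℕ) := nonempty_embedding_nat V₁
  obtain ⟨e₂⟩ : Nonempty (V₂ ↪ ℕ) := nonempty_embedding_nat V₂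
  obtain ⟨Γ, _, _, h, P, code, -, hR⟩ := exists_recognises H (φ.below_tr e₁ e₂)
  rw [le_himp_iff, hSatisfies_eq_mSat_toCore e₁ e₂]
  exact hR.em inf_le_left fun k => inf_le_right.trans (I.extent_le_toCore e₁ e₂ k)

theorem hRF_le_satisfiable_iff (H : Type u) [Order.Frame H] {V₁ : Type v} {V₂ : Type w}
    [DecidableEq V₁] [DecidableEq V₂] (e₁ : V₁ ↪ ℕ) (e₂ : V₂ ↪ ℕ) (φ : Form V₁ V₂) :
    hRF H ≤ (hSatisfiable H φ ⇨ truth H (decideSat (φ.code e₁ e₂) = true)) ⊓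
      (truth H (decideSat (φ.code e₁ e₂) = true) ⇨ hSatisfiable H φ) := by
  have hN := φ.below_tr e₁ e₂
  obtain ⟨Γ, _, _, h, P, code, hT, hR⟩ := exists_recognises H
    (below_closure (fun k hk => List.mem_range.1 hk) hN)
  have hf : decideSat (φ.code e₁ e₂) = true ↔ P (h fun _ => false) (h fun _ => false) := by
    have h0 : Nat.testBit 0 = fun _ => false := funext Nat.zero_testBit
    rw [← hT.acc, ← h0, ← hT.letter 0 (by positivity), tab_closure, ← nextTab_code]
    rfl
  have hc := hR.const
  rw [← hSatisfiable_eq_closure e₁ e₂ hN] at hc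
  rw [hf, le_inf_iff, le_himp_iff, le_himp_iff]
  by_cases hP : P (h fun _ => false) (h fun _ => false)
  · rw [truth_of hP]
    exact ⟨le_top, inf_le_left.trans (hc.1 hP)⟩
  · rw [truth_of_not hP]
    exact ⟨hc.2 hP, inf_le_right.trans bot_le⟩

/-! ### The ordinary reading -/

theorem truth_prop (p : Prop) : truth Prop p ↔ p := by simp [truth]

/-- Over `Prop` a functional relation is the graph of a function, by choice; the ordinary reading is
thus the case `H = Prop`. -/
theorem extent_prop {A : Type v} {σ : HSeq Prop A} : σ.extent ↔ ∃ s : ℕ → A, σ = const s := by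
  constructor
  · intro h
    obtain ⟨tot, func⟩ := (HSeq.le_extent_iff (u := (⊤ : Prop))).1 fun _ => h
    have tot' : ∀ n, ∃ a, σ n a := fun n => by simpa using tot n trivial
    choose s hs using tot'
    refine ⟨s, ?_⟩
    funext n b
    refine propext ⟨fun hb => func n b (s n) ⟨trivial, hb, hs n⟩, fun hb => ?_⟩
    rw [(truth_prop _).1 hb]
    exact hs n
  · rintro ⟨s, rfl⟩
    rw [extent_const]
    trivial

theorem hRF_prop (h : RF) : hRF Prop := by
  simp only [hRF, iInf_Prop_eq, iSup_Prop_eq]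
  intro Γ _ _ σ hσ
  obtain ⟨s, rfl⟩ := extent_prop.1 hσ
  obtain ⟨t, hf, hc⟩ := h Γ _ ‹_› s
  refine ⟨const t, extent_prop.2 ⟨t, rfl⟩, ?_, ?_⟩
  · simp only [hIsFactorisation, iInf_Prop_eq]
    intro ws hws j
    have e : (List.range ws.length).map t = ws := by
      refine List.ext_getElem (by simp) fun i hi hi' => ?_
      have := (truth_prop _).1 (hws ⟨i, hi'⟩)
      simpa using this.symm
    refine (truth_prop _).2 ?_
    have key : ∀ ws', ws' = ws → (∀ j : Fin (concat ws').length, s j = (concat ws').get j) →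
        (concat ws).get j = s j := by
      rintro _ rfl h
      exact (h j).symm
    exact key _ e (hf ws.length)
  · simp only [iInf_Prop_eq]
    rintro i j x y ⟨hx, hy⟩
    rw [truth_prop, (truth_prop _).1 hx, (truth_prop _).1 hy]
    exact hc i j

theorem hSatisfies_prop {V₁ : Type v} {V₂ : Type w} [DecidableEq V₁] [DecidableEq V₂]
    (φ : Form V₁ V₂) : ∀ I : Interp V₁ V₂,
      hSatisfies (⟨I.fst, fun X => const (I.snd X)⟩ : HInterp Prop V₁ V₂) φ ↔ Satisfies I φ := by
  have update_const : ∀ (I : Interp V₁ V₂) (X : V₂) (β : ℕ → Bool),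
      (Function.update (fun X => const (I.snd X)) X (const β) : V₂ → HSeq Prop Bool) =
        fun Y => const (Function.update I.snd X β Y) := by
    intro I X β
    funext Y
    rcases eq_or_ne Y X with rfl | hY
    · simp
    · simp [Function.update_of_ne hY]
  induction φ with
  | lt x y => exact fun I => truth_prop _
  | mem x X => exact fun I => (truth_prop _).trans eq_comm
  | and φ ψ ihφ ihψ => exact fun I => and_congr (ihφ I) (ihψ I)
  | neg φ ih => exact fun I => not_congr (ih I)
  | exFst x φ ih =>
    intro I
    simp only [hSatisfies, Satisfies, iSup_Prop_eq]
    exact exists_congr fun n => ih ⟨Function.update I.fst x n, I.snd⟩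
  | exSnd X φ ih =>
    intro I
    simp only [hSatisfies, Satisfies, iSup_Prop_eq]
    constructor
    · rintro ⟨β, hβ, h⟩
      obtain ⟨b, rfl⟩ := extent_prop.1 hβ
      rw [update_const] at h
      exact ⟨b, (ih ⟨I.fst, Function.update I.snd X b⟩).1 h⟩
    · rintro ⟨b, hb⟩
      refine ⟨const b, extent_prop.2 ⟨b, rfl⟩, ?_⟩
      rw [update_const]
      exact (ih ⟨I.fst, Function.update I.snd X b⟩).2 hb

theorem satisfies_em (h : RF) {V₁ : Type v} {V₂ : Type w} [Finite V₁] [Finite V₂]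
    [DecidableEq V₁] [DecidableEq V₂] (I : Interp V₁ V₂) (φ : Form V₁ V₂) :
    Satisfies I φ ∨ ¬ Satisfies I φ := by
  rw [← hSatisfies_prop]
  refine hRF_le_em Prop ⟨I.fst, fun X => const (I.snd X)⟩ φ (hRF_prop h) ?_
  simp only [HInterp.extent, iInf_Prop_eq]
  exact fun X => extent_prop.2 ⟨_, rfl⟩

theorem hSatisfiable_prop {V₁ : Type v} {V₂ : Type w} [DecidableEq V₁] [DecidableEq V₂]
    (φ : Form V₁ V₂) : hSatisfiable Prop φ ↔ ∃ I : Interp V₁ V₂, Satisfies I φ := by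
  simp only [hSatisfiable, iSup_Prop_eq]
  constructor
  · rintro ⟨⟨f, s⟩, hI, h⟩
    have hI' : ∀ X, ∃ b : ℕ → Bool, s X = const b := fun X =>
      extent_prop.1 ((iInf_Prop_eq ▸ hI : ∀ X, (s X).extent) X)
    choose b hb using hI'
    obtain rfl : s = fun X => const (b X) := funext hb
    exact ⟨⟨f, b⟩, (hSatisfies_prop φ ⟨f, b⟩).1 h⟩
  · rintro ⟨I, hI⟩
    refine ⟨_, ?_, (hSatisfies_prop φ I).2 hI⟩
    simp only [HInterp.extent, iInf_Prop_eq]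
    exact fun X => extent_prop.2 ⟨_, rfl⟩

theorem satisfiable_iff (h : RF) {V₁ : Type v} {V₂ : Type w} (e₁ : V₁ ↪ ℕ) (e₂ : V₂ ↪ ℕ)
    [DecidableEq V₁] [DecidableEq V₂] (φ : Form V₁ V₂) :
    (∃ I : Interp V₁ V₂, Satisfies I φ) ↔ decideSat (φ.code e₁ e₂) = true := by
  rw [← hSatisfiable_prop, ← truth_prop (decideSat (φ.code e₁ e₂) = true)]
  have := hRF_le_satisfiable_iff Prop e₁ e₂ φ (hRF_prop h)
  exact ⟨this.1, this.2⟩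

end S1S

theorem mainTheorem2 :
    -- the ordinary reading
    (S1S.RF →
      (∀ (V₁ : Type v) (V₂ : Type w) [Finite V₁] [Finite V₂] [DecidableEq V₁] [DecidableEq V₂]
        (I : S1S.Interp V₁ V₂) (φ : S1S.Form V₁ V₂),
        S1S.Satisfies I φ ∨ ¬ S1S.Satisfies I φ) ∧
      (∃ f : ℕ → Bool, Computable f ∧
        ∀ (V₁ : Type v) (V₂ : Type w) [Finite V₁] [Finite V₂] [DecidableEq V₁] [DecidableEq V₂]
          (e₁ : V₁ ↪ ℕ) (e₂ : V₂ ↪ ℕ) (φ : S1S.Form V₁ V₂),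
          (∃ I : S1S.Interp V₁ V₂, S1S.Satisfies I φ) ↔ f (φ.code e₁ e₂) = true)) ∧
    -- the constructive reading
    (∀ (H : Type u) [Order.Frame H] (V₁ : Type v) (V₂ : Type w) [Finite V₁] [Finite V₂]
      [DecidableEq V₁] [DecidableEq V₂],
      S1S.hRF H ≤ ⨅ (I : S1S.HInterp H V₁ V₂) (φ : S1S.Form V₁ V₂),
        I.extent ⇨ (S1S.hSatisfies I φ ⊔ (S1S.hSatisfies I φ)ᶜ)) ∧
    (∃ f : ℕ → Bool, Computable f ∧
      ∀ (H : Type u) [Order.Frame H] (V₁ : Type v) (V₂ : Type w) [Finite V₁] [Finite V₂]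
        [DecidableEq V₁] [DecidableEq V₂] (e₁ : V₁ ↪ ℕ) (e₂ : V₂ ↪ ℕ) (φ : S1S.Form V₁ V₂),
        S1S.hRF H ≤
          (S1S.hSatisfiable H φ ⇨ S1S.truth H (f (φ.code e₁ e₂) = true)) ⊓
            (S1S.truth H (f (φ.code e₁ e₂) = true) ⇨ S1S.hSatisfiable H φ)) := by
  refine ⟨fun h => ⟨fun V₁ V₂ _ _ _ _ I φ => S1S.satisfies_em h I φ, S1S.decideSat,
    S1S.primrec_decideSat.to_comp, fun V₁ V₂ _ _ _ _ e₁ e₂ φ => S1S.satisfiable_iff h e₁ e₂ φ⟩,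
    fun H _ V₁ V₂ _ _ _ _ => le_iInf fun I => le_iInf fun φ => S1S.hRF_le_em H I φ,
    S1S.decideSat, S1S.primrec_decideSat.to_comp,
    fun H _ V₁ V₂ _ _ _ _ e₁ e₂ φ => S1S.hRF_le_satisfiable_iff H e₁ e₂ φ⟩
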